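/- Let $B,C>0$, $b\ge 1$, $0<\epsilon<\tfrac12$ and $0\le\lambda<\frac{C}{2B}$. Let $\Omega=[-1,1]\times[-1,1]$ and let $S_0$ be the space of real symmetric traceless $2\times 2$ matrices, with $|\mathbf P|^2=\operatorname{tr}(\mathbf P^2)$. Let $T_\epsilon:[-1,1]\to\mathbb R$ be given by $T_\epsilon(t)=(1+t)/\epsilon$ for $-1\le t\le -1+\epsilon$, $T_\epsilon(t)=1$ for $|t|\le 1-\epsilon$, and $T_\epsilon(t)=(1-t)/\epsilon$ for $1-\epsilon\le t\le 1$, and define $\mathbf P_{bc}:\partial\Omega\to S_0$ by $$\mathbf P_{bc}(\pm1,y)=\frac{B}{2C}\begin{pmatrix}-T_\epsilon(y)&0\\0&T_\epsilon(y)\end{pmatrix},\qquad \mathbf P_{bc}(x,\pm1)=\frac{B}{2C}\begin{pmatrix}T_\epsilon(x)&0\\0&-T_\epsilon(x)\end{pmatrix}.$$ Let $\mathcal A=\{\mathbf P\in H^1(\Omega;S_0):\ \mathbf P=\mathbf P_{bc}\text{ on }\partial\Omega\}$, the boundary condition being understood in the sense of traces, and consider on $\mathcal A$ the rescaled reduced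 Landau--de Gennes energy $$E[\mathbf P]=\int_\Omega\left[\frac1{2b^2}|\mathbf P_x|^2+\frac12|\mathbf P_y|^2+\frac{\lambda^2}{2C}\left(-\frac{B^2}{4C}|\mathbf P|^2+\frac C4|\mathbf P|^4\right)\right]\mathrm dA .$$ A critical point of $E$ in $\mathcal A$ is a $\mathbf P\in\mathcal A$ such that $\frac{\mathrm d}{\mathrm dt}E[\mathbf P+t\mathbf V]\big|_{t=0}=0$ for every $\mathbf V\in H^1_0(\Omega;S_0)$. Then $E$ has exactly one critical point $\mathbf P$ in $\mathcal A$ (up to equality almost everywhere), and it satisfies $P_{12}=0$ almost everywhere in $\Omega$. -/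

import Mathlib

open MeasureTheory Filter Topology Set
open scoped ContDiff

noncomputable section

namespace RLdG

/-! ### Order parameters: symmetric traceless `2 × 2` matrices -/

/-- The space `S₀` of real symmetric traceless `2 × 2` matrices. -/
def S0 : Submodule ℝ (Matrix (Fin 2) (Fin 2) ℝ) where
  carrier := {A | A.IsSymm ∧ A.trace = 0}
  add_mem' := by
    rintro A B ⟨hA, hA'⟩ ⟨hB, hB'⟩
    exact ⟨hA.add hB, by rw [Matrix.trace_add, hA', hB', add_zero]⟩
  zero_mem' := ⟨Matrix.isSymm_zero, Matrix.trace_zero _ _⟩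
  smul_mem' := by
    rintro c A ⟨hA, hA'⟩
    exact ⟨hA.smul c, by rw [Matrix.trace_smul, hA', smul_zero]⟩

/-- The diagonal matrix `diag(a, -a)`, as an element of `S₀`. -/
def diagS0 (a : ℝ) : S0 :=
  ⟨!![a, 0; 0, -a], by
    refine ⟨?_, ?_⟩
    · ext i j; fin_cases i <;> fin_cases j <;> rfl
    · simp [Matrix.trace_fin_two]⟩

/-- `|A|² = tr(A A)`. -/
def normSq (A : Matrix (Fin 2) (Fin 2) ℝ) : ℝ := (A * A).trace

/-- The `(i, j)` entry of an `S₀`-valued map. -/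
def entry (P : ℝ × ℝ → S0) (i j : Fin 2) : ℝ × ℝ → ℝ :=
  fun z => (P z : Matrix (Fin 2) (Fin 2) ℝ) i j

/-! ### The square, weak derivatives, `H¹` and traces -/

/-- The (open) square `(-1, 1) × (-1, 1)`. -/
def Om : Set (ℝ × ℝ) := Ioo (-1) 1 ×ˢ Ioo (-1) 1

/-- Lebesgue measure on the square. -/
def area : Measure (ℝ × ℝ) := volume.restrict Om

/-- Arc length measure on the boundary of the square: the sum of the length measures on its four
edges `x = 1`, `x = -1`, `y = 1`, `y = -1`. -/
def arcLength : Measure (ℝ × ℝ) :=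
  (volume.restrict (Icc (-1 : ℝ) 1)).map (fun t => ((1 : ℝ), t)) +
  (volume.restrict (Icc (-1 : ℝ) 1)).map (fun t => ((-1 : ℝ), t)) +
  (volume.restrict (Icc (-1 : ℝ) 1)).map (fun t => (t, (1 : ℝ))) +
  (volume.restrict (Icc (-1 : ℝ) 1)).map (fun t => (t, (-1 : ℝ)))

/-- `g` is the weak derivative of `u` in the direction `e` on the square. -/
def HasWeakDeriv (e : ℝ × ℝ) (u g : ℝ × ℝ → ℝ) : Prop :=
  LocallyIntegrableOn u Om ∧ LocallyIntegrableOn g Om ∧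
  ∀ φ : ℝ × ℝ → ℝ, ContDiff ℝ ∞ φ → HasCompactSupport φ → tsupport φ ⊆ Om →
    ∫ z, u z * fderiv ℝ φ z e ∂area = - ∫ z, g z * φ z ∂area

open Classical in
/-- The weak derivative of `u` in the direction `e` (unique up to null sets when it exists;
`0` when it does not exist). -/
def weakDeriv (e : ℝ × ℝ) (u : ℝ × ℝ → ℝ) : ℝ × ℝ → ℝ :=
  if h : ∃ g, HasWeakDeriv e u g then h.choose else 0

/-- `u ∈ H¹(Ω)`. -/
def MemH1 (u : ℝ × ℝ → ℝ) : Prop :=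
  MemLp u 2 area ∧
  (∃ g, HasWeakDeriv (1, 0) u g ∧ MemLp g 2 area) ∧
  (∃ g, HasWeakDeriv (0, 1) u g ∧ MemLp g 2 area)

/-- The trace of `u ∈ H¹(Ω)` on `∂Ω` is `g`. The trace operator is the continuous extension to
`H¹(Ω)`, with values in `L²(∂Ω)`, of the restriction map `v ↦ v|_{∂Ω}` on functions that are `C¹` up
to the boundary: `u` has trace `g` iff `C¹` functions `v n` converge to `u` in `H¹(Ω)` while their
restrictions converge to `g` in `L²(∂Ω)`. -/
def HasTrace (u g : ℝ × ℝ → ℝ) : Prop :=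
  ∃ v : ℕ → ℝ × ℝ → ℝ,
    (∀ n, ContDiff ℝ 1 (v n)) ∧
    Tendsto (fun n => eLpNorm (fun z => v n z - u z) 2 area) atTop (𝓝 0) ∧
    Tendsto (fun n => eLpNorm (fun z => fderiv ℝ (v n) z (1, 0) - weakDeriv (1, 0) u z) 2 area)
      atTop (𝓝 0) ∧
    Tendsto (fun n => eLpNorm (fun z => fderiv ℝ (v n) z (0, 1) - weakDeriv (0, 1) u z) 2 area)
      atTop (𝓝 0) ∧
    Tendsto (fun n => eLpNorm (fun z => v n z - g z) 2 arcLength) atTop (𝓝 0)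

/-- The maps `P ∈ H¹(Ω; S₀)` with `P = G` on `∂Ω` in the sense of traces. -/
def H1WithTrace (G : ℝ × ℝ → S0) : Set (ℝ × ℝ → S0) :=
  {P | ∀ i j, MemH1 (entry P i j) ∧ HasTrace (entry P i j) (entry G i j)}

/-! ### Boundary data, energy and critical points -/

/-- The trapezoidal function `T_ε` on `[-1, 1]`. -/
def trap (ε t : ℝ) : ℝ :=
  if t ≤ -1 + ε then (1 + t) / ε else if t ≤ 1 - ε then 1 else (1 - t) / ε

/-- The tangent Dirichlet data on the boundary of the square: `(B/2C) diag(-T_ε(y), T_ε(y))` on the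
edges `x = ±1` and `(B/2C) diag(T_ε(x), -T_ε(x))` on the edges `y = ±1` (both vanish at the
corners). -/
def Pbc (B C ε : ℝ) (z : ℝ × ℝ) : S0 :=
  if |z.1| = 1 then diagS0 (B / (2 * C) * -trap ε z.2) else diagS0 (B / (2 * C) * trap ε z.1)

/-- The admissible space `𝒜`. -/
def Adm (B C ε : ℝ) : Set (ℝ × ℝ → S0) := H1WithTrace (Pbc B C ε)

/-- The entrywise weak derivative of an `S₀`-valued map in the direction `e`. -/
def weakDerivS0 (e : ℝ × ℝ) (P : ℝ × ℝ → S0) (z : ℝ × ℝ) : Matrix (Fin 2) (Fin 2) ℝ :=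
  Matrix.of fun i j => weakDeriv e (entry P i j) z

/-- The rescaled reduced Landau–de Gennes energy. -/
def energy (B C b lam : ℝ) (P : ℝ × ℝ → S0) : ℝ :=
  ∫ z, (1 / (2 * b ^ 2) * normSq (weakDerivS0 (1, 0) P z)
      + 1 / 2 * normSq (weakDerivS0 (0, 1) P z)
      + lam ^ 2 / (2 * C) * (-(B ^ 2 / (4 * C)) * normSq (P z)
          + C / 4 * normSq (P z) ^ 2)) ∂area

/-- `P` is a critical point of the energy in `𝒜`: `P ∈ 𝒜`, and the first variation of the energy
at `P` vanishes in every direction `V ∈ H¹₀(Ω; S₀)`. -/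
def IsCriticalPoint (B C ε b lam : ℝ) (P : ℝ × ℝ → S0) : Prop :=
  P ∈ Adm B C ε ∧
  ∀ V ∈ H1WithTrace 0, HasDerivAt (fun t : ℝ => energy B C b lam (P + t • V)) 0 0

end RLdG

end

noncomputable section

namespace RLdG

/-! ### The two measures -/

/-! With `P₁₁ = u`, `P₁₂ = w` the energy is `∫ α|u_x|² + |u_y|² - κu²`, plus the same expression in
`w`, plus `μ ∫ (u² + w²)²`, where `α = 1/b²`, `κ = λ²B²/(4C²)`, `μ = λ²/2`. The quartic term is
convex. The only concave term is `-κ(u² + w²)`, and the Poincaré inequality `‖v‖² ≤ 16‖v_y‖²` for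
zero trace (`Jets.poincare`) absorbs it when `κ < 1/16`, which is exactly `λ < C/(2B)`. So the
energy is uniformly convex on `𝒜`: its first variation is strictly monotone
(`le_firstVariation_sub`) and two critical points coincide (`eq_of_firstVariation_eq_zero`).

For existence, the energy is minimised over maps with `w = 0` only (`exists_min_jetEnergy`); uniform
convexity makes minimising sequences Cauchy, so no weak compactness is needed. Turning on `w` with
zero trace can only raise the energy, so this minimiser is critical in every direction
(`firstVariation_eq_zero_of_min`). By uniqueness it is the critical point, and its `P₁₂` vanishes by
construction.

Analytically, `H¹` with traces is modelled as the closure `Jets` of the quadruples `(v, v_x, v_y,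
v|∂Ω)`, `v` of class `C¹`, in a product of `L²` spaces. The embedding into `L⁴` makes the quartic
term continuous there, and `isCriticalPoint_iff` translates back. An explicit `H¹` extension of the
boundary data shows that `𝒜` is nonempty. -/

instance : IsFiniteMeasure area := by
  refine ⟨?_⟩
  rw [area, Measure.restrict_apply_univ]
  exact ((isCompact_Icc.prod isCompact_Icc).measure_lt_top).trans_le' <|
    measure_mono (Set.prod_mono Ioo_subset_Icc_self (Ioo_subset_Icc_self (a := (-1 : ℝ)) (b := 1)))

instance : IsFiniteMeasure arcLength := by
  unfold arcLength
  infer_instance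

theorem isOpen_Om : IsOpen Om := isOpen_Ioo.prod isOpen_Ioo

theorem measurableSet_Om : MeasurableSet Om := isOpen_Om.measurableSet

/-- The closed square. -/
def clOm : Set (ℝ × ℝ) := Icc (-1) 1 ×ˢ Icc (-1) 1

theorem isCompact_clOm : IsCompact clOm := isCompact_Icc.prod isCompact_Icc

theorem ae_area_mem_Om : ∀ᵐ z ∂area, z ∈ Om := ae_restrict_mem measurableSet_Om

theorem ae_area_mem_clOm : ∀ᵐ z ∂area, z ∈ clOm := by
  filter_upwards [ae_area_mem_Om] with z hz
  exact Set.prod_mono Ioo_subset_Icc_self Ioo_subset_Icc_self hz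

/-- The four edges of the square. -/
def edges : Set (ℝ × ℝ) := {z | z ∈ clOm ∧ (|z.1| = 1 ∨ |z.2| = 1)}

theorem measurableSet_edges : MeasurableSet edges := by
  refine isCompact_clOm.measurableSet.inter (MeasurableSet.union ?_ ?_)
  · exact (isClosed_eq (continuous_abs.comp continuous_fst) continuous_const).measurableSet
  · exact (isClosed_eq (continuous_abs.comp continuous_snd) continuous_const).measurableSet

theorem ae_arcLength_mem_edges : ∀ᵐ z ∂arcLength, z ∈ edges := by
  have key : ∀ f : ℝ → ℝ × ℝ, Measurable f → (∀ t ∈ Icc (-1 : ℝ) 1, f t ∈ edges) →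
      ∀ᵐ z ∂((volume.restrict (Icc (-1 : ℝ) 1)).map f), z ∈ edges := by
    intro f hf h
    refine (ae_map_iff hf.aemeasurable measurableSet_edges).2 ?_
    filter_upwards [ae_restrict_mem measurableSet_Icc] with t ht using h t ht
  simp only [arcLength, ae_add_measure_iff]
  refine ⟨⟨⟨?_, ?_⟩, ?_⟩, ?_⟩ <;> refine key _ (by fun_prop) fun t ht => ?_ <;>
    simp [edges, clOm, ht.1, ht.2]

theorem ae_arcLength_mem_clOm : ∀ᵐ z ∂arcLength, z ∈ clOm :=
  ae_arcLength_mem_edges.mono fun _ h => h.1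

theorem memLp_of_continuous {μ : Measure (ℝ × ℝ)} [IsFiniteMeasure μ] (hμ : ∀ᵐ z ∂μ, z ∈ clOm)
    {f : ℝ × ℝ → ℝ} (hf : Continuous f) (p : ENNReal) : MemLp f p μ := by
  obtain ⟨K, hK⟩ := isCompact_clOm.exists_bound_of_continuousOn hf.continuousOn
  exact MemLp.of_bound hf.aestronglyMeasurable K (hμ.mono fun z hz => hK z hz)

theorem continuous_fderiv_apply {v : ℝ × ℝ → ℝ} (hv : ContDiff ℝ 1 v) (e : ℝ × ℝ) :
    Continuous fun z => fderiv ℝ v z e :=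
  (hv.continuous_fderiv one_ne_zero).clm_apply continuous_const

/-! ### Weak derivatives -/

theorem _root_.MeasureTheory.MemLp.locallyIntegrableOn_Om {u : ℝ × ℝ → ℝ} (hu : MemLp u 2 area) :
    LocallyIntegrableOn u Om :=
  IntegrableOn.locallyIntegrableOn (hu.integrable one_le_two)

theorem HasWeakDeriv.congr {e : ℝ × ℝ} {u u' g g' : ℝ × ℝ → ℝ} (h : HasWeakDeriv e u g)
    (hu : u =ᵐ[area] u') (hg : g =ᵐ[area] g') : HasWeakDeriv e u' g' := by
  have loc : ∀ {f f' : ℝ × ℝ → ℝ}, f =ᵐ[area] f' → LocallyIntegrableOn f Om →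
      LocallyIntegrableOn f' Om := by
    intro f f' hff hf x hx
    obtain ⟨U, hU, hfU⟩ := hf x hx
    refine ⟨U ∩ Om, inter_mem hU self_mem_nhdsWithin, ?_⟩
    exact (hfU.mono_set inter_subset_left).congr_fun_ae
      (ae_mono (Measure.restrict_mono inter_subset_right le_rfl) hff)
  refine ⟨loc hu h.1, loc hg h.2.1, fun φ h1 h2 h3 => ?_⟩
  have e1 : ∫ z, u z * fderiv ℝ φ z e ∂area = ∫ z, u' z * fderiv ℝ φ z e ∂area :=
    integral_congr_ae (hu.mono fun z hz => by simp only [hz])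
  have e2 : ∫ z, g z * φ z ∂area = ∫ z, g' z * φ z ∂area :=
    integral_congr_ae (hg.mono fun z hz => by simp only [hz])
  rw [← e1, ← e2, h.2.2 φ h1 h2 h3]

/-- The fundamental lemma of the calculus of variations applied to `g - g'`. -/
theorem HasWeakDeriv.unique {e : ℝ × ℝ} {u g g' : ℝ × ℝ → ℝ} (h : HasWeakDeriv e u g)
    (h' : HasWeakDeriv e u g') : g =ᵐ[area] g' := by
  have int : ∀ {f φ : ℝ × ℝ → ℝ}, LocallyIntegrableOn f Om → Continuous φ → HasCompactSupport φ →
      tsupport φ ⊆ Om → Integrable (fun z => f z * φ z) area := by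
    intro f φ hf hφ hc hs
    have h1 : IntegrableOn f (tsupport φ) := hf.integrableOn_compact_subset hs hc
    have h2 : IntegrableOn (fun z => f z * φ z) (tsupport φ) :=
      h1.mul_continuousOn hφ.continuousOn hc
    refine Integrable.mono_measure ?_ Measure.restrict_le_self
    rw [← integrableOn_iff_integrable_of_support_subset
      (((Function.support_mul_subset_right _ _).trans (subset_tsupport φ)))]
    exact h2
  have := isOpen_Om.ae_eq_zero_of_integral_contDiff_smul_eq_zero (μ := volume)
    (f := fun z => g z - g' z) (h.2.1.sub h'.2.1) ?_
  · refine (ae_restrict_iff' measurableSet_Om).2 ?_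
    filter_upwards [this] with z hz hzO
    exact sub_eq_zero.1 (hz hzO)
  · intro φ h1 h2 h3
    have e1 := h.2.2 φ h1 h2 h3
    have e2 := h'.2.2 φ h1 h2 h3
    have e3 : ∫ z, φ z • (g z - g' z) = ∫ z, φ z • (g z - g' z) ∂area := by
      refine (setIntegral_eq_integral_of_forall_compl_eq_zero fun z hz => ?_).symm
      rw [image_eq_zero_of_notMem_tsupport fun hz' => hz (h3 hz'), zero_smul]
    rw [e3]
    have e4 : ∀ z, φ z • (g z - g' z) = g z * φ z - g' z * φ z := fun z => by
      rw [smul_eq_mul]; ring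
    simp_rw [e4]
    rw [integral_sub (int h.2.1 h1.continuous h2 h3) (int h'.2.1 h1.continuous h2 h3)]
    linarith

/-- `weakDeriv` is an arbitrary choice; this lets any known weak derivative replace it under an
integral. -/
theorem HasWeakDeriv.weakDeriv_ae_eq {e : ℝ × ℝ} {u g : ℝ × ℝ → ℝ} (h : HasWeakDeriv e u g) :
    weakDeriv e u =ᵐ[area] g := by
  have hex : ∃ g, HasWeakDeriv e u g := ⟨g, h⟩
  rw [weakDeriv, dif_pos hex]
  exact hex.choose_spec.unique h

theorem hasWeakDeriv_fderiv {v : ℝ × ℝ → ℝ} (hv : ContDiff ℝ 1 v) (e : ℝ × ℝ) :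
    HasWeakDeriv e v fun z => fderiv ℝ v z e := by
  refine ⟨(memLp_of_continuous ae_area_mem_clOm hv.continuous 2).locallyIntegrableOn_Om,
    (memLp_of_continuous ae_area_mem_clOm
      (continuous_fderiv_apply hv e) 2).locallyIntegrableOn_Om, fun φ h1 h2 h3 => ?_⟩
  have hφ1 : ContDiff ℝ 1 φ := h1.of_le (by exact_mod_cast le_top)
  have hd : HasCompactSupport fun z => fderiv ℝ φ z e :=
    h2.fderiv_apply (𝕜 := ℝ) e
  -- Since `φ` is supported inside the open square, one may integrate by parts over the whole plane
  -- without boundary terms.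
  have key := integral_mul_fderiv_eq_neg_fderiv_mul_of_integrable (μ := (volume : Measure (ℝ × ℝ)))
    (𝕜 := ℝ) (f := v) (g := φ) (v := e)
    (((continuous_fderiv_apply hv e).mul h1.continuous).integrable_of_hasCompactSupport
      h2.mul_left)
    ((hv.continuous.mul (continuous_fderiv_apply hφ1 e)).integrable_of_hasCompactSupport
      hd.mul_left)
    ((hv.continuous.mul h1.continuous).integrable_of_hasCompactSupport h2.mul_left)
    (fun z _ => hv.differentiable one_ne_zero z) (fun z _ => hφ1.differentiable one_ne_zero z)
  have r1 : ∫ z, v z * fderiv ℝ φ z e ∂area = ∫ z, v z * fderiv ℝ φ z e := by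
    refine setIntegral_eq_integral_of_forall_compl_eq_zero fun z hz => ?_
    rw [fderiv_of_notMem_tsupport (𝕜 := ℝ) (f := φ) (x := z) fun hz' => hz (h3 hz')]
    simp
  have r2 : ∫ z, fderiv ℝ v z e * φ z ∂area = ∫ z, fderiv ℝ v z e * φ z := by
    refine setIntegral_eq_integral_of_forall_compl_eq_zero fun z hz => ?_
    rw [image_eq_zero_of_notMem_tsupport fun hz' => hz (h3 hz'), mul_zero]
  rw [r1, r2, key]

/-! ### The Sobolev space with traces as a closed subspace of a product of `L²` spaces -/

/-- Quadruples `(u, u_x, u_y, u|∂Ω)`. -/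
abbrev X : Type := Lp ℝ 2 area × Lp ℝ 2 area × Lp ℝ 2 area × Lp ℝ 2 arcLength

/-- `x` is the quadruple of the `C¹` function `v`. -/
structure IsC1Jet (x : X) (v : ℝ × ℝ → ℝ) : Prop where
  contDiff : ContDiff ℝ 1 v
  val : x.1 =ᵐ[area] v
  dx : x.2.1 =ᵐ[area] fun z => fderiv ℝ v z (1, 0)
  dy : x.2.2.1 =ᵐ[area] fun z => fderiv ℝ v z (0, 1)
  bd : x.2.2.2 =ᵐ[arcLength] v

theorem exists_isC1Jet {v : ℝ × ℝ → ℝ} (hv : ContDiff ℝ 1 v) : ∃ x : X, IsC1Jet x v := by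
  have m0 := memLp_of_continuous ae_area_mem_clOm hv.continuous 2
  have m1 := memLp_of_continuous ae_area_mem_clOm (continuous_fderiv_apply hv (1, 0)) 2
  have m2 := memLp_of_continuous ae_area_mem_clOm (continuous_fderiv_apply hv (0, 1)) 2
  have m3 := memLp_of_continuous ae_arcLength_mem_clOm hv.continuous 2
  exact ⟨⟨m0.toLp, m1.toLp, m2.toLp, m3.toLp⟩, hv, m0.coeFn_toLp, m1.coeFn_toLp, m2.coeFn_toLp,
    m3.coeFn_toLp⟩

/-- The quadruples of `C¹` functions. -/
def C1Jets : Submodule ℝ X where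
  carrier := {x | ∃ v, IsC1Jet x v}
  add_mem' := by
    rintro x y ⟨v, hv⟩ ⟨w, hw⟩
    have hd : ∀ z, fderiv ℝ (v + w) z = fderiv ℝ v z + fderiv ℝ w z := fun z =>
      fderiv_add (hv.contDiff.differentiable one_ne_zero z)
        (hw.contDiff.differentiable one_ne_zero z)
    refine ⟨v + w, hv.contDiff.add hw.contDiff, ?_, ?_, ?_, ?_⟩
    · exact (Lp.coeFn_add x.1 y.1).trans (hv.val.add hw.val)
    · simpa only [hd] using! (Lp.coeFn_add x.2.1 y.2.1).trans (hv.dx.add hw.dx)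
    · simpa only [hd] using! (Lp.coeFn_add x.2.2.1 y.2.2.1).trans (hv.dy.add hw.dy)
    · exact (Lp.coeFn_add x.2.2.2 y.2.2.2).trans (hv.bd.add hw.bd)
  zero_mem' := by
    refine ⟨0, contDiff_const, Lp.coeFn_zero _ _ _, ?_, ?_, Lp.coeFn_zero _ _ _⟩ <;>
    · refine (Lp.coeFn_zero _ _ _).trans (.of_forall fun z => ?_)
      simp
  smul_mem' := by
    rintro c x ⟨v, hv⟩
    have hd : ∀ z, fderiv ℝ (c • v) z = c • fderiv ℝ v z := fun z =>
      fderiv_const_smul (hv.contDiff.differentiable one_ne_zero z) c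
    refine ⟨c • v, hv.contDiff.const_smul c, ?_, ?_, ?_, ?_⟩
    · exact (Lp.coeFn_smul c x.1).trans (hv.val.const_smul c)
    · simpa only [hd] using! (Lp.coeFn_smul c x.2.1).trans (hv.dx.const_smul c)
    · simpa only [hd] using! (Lp.coeFn_smul c x.2.2.1).trans (hv.dy.const_smul c)
    · exact (Lp.coeFn_smul c x.2.2.2).trans (hv.bd.const_smul c)

/-- `H¹` functions on the square with their weak derivatives and traces. -/
def Jets : Submodule ℝ X := C1Jets.topologicalClosure

theorem Jets.exists_seq {x : X} (hx : x ∈ Jets) :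
    ∃ (y : ℕ → X) (v : ℕ → ℝ × ℝ → ℝ), (∀ n, IsC1Jet (y n) (v n)) ∧ Tendsto y atTop (𝓝 x) := by
  obtain ⟨y, hy, hlim⟩ := mem_closure_iff_seq_limit.1 hx
  choose v hv using hy
  exact ⟨y, v, hv, hlim⟩

theorem IsC1Jet.mem {x : X} {v : ℝ × ℝ → ℝ} (h : IsC1Jet x v) : x ∈ Jets :=
  subset_closure ⟨v, h⟩

theorem isClosed_Jets : IsClosed (Jets : Set X) := isClosed_closure

/-- A closed condition that holds for the quadruples of `C¹` functions holds on `Jets`. -/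
theorem Jets.induction {p : X → Prop} (hp : IsClosed {x | p x})
    (h : ∀ x v, IsC1Jet x v → p x) {x : X} (hx : x ∈ Jets) : p x :=
  closure_minimal (s := (C1Jets : Set X)) (by rintro y ⟨v, hv⟩; exact h y v hv) hp hx

theorem integral_mul_toLp {f : ℝ × ℝ → ℝ} (hf : MemLp f 2 area) (u : Lp ℝ 2 area) :
    ∫ z, u z * f z ∂area = inner ℝ (hf.toLp f) u := by
  rw [L2.inner_def]
  refine integral_congr_ae ?_
  filter_upwards [hf.coeFn_toLp] with z hz
  rw [hz]
  simp

/-- For a fixed test function both sides are inner products with fixed `L²` functions, so the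
identity is a closed condition and passes from `C¹` functions to limits. -/
theorem Jets.hasWeakDeriv_aux {x : X} (hx : x ∈ Jets) :
    HasWeakDeriv (1, 0) x.1 x.2.1 ∧ HasWeakDeriv (0, 1) x.1 x.2.2.1 := by
  suffices H : ∀ φ : ℝ × ℝ → ℝ, ContDiff ℝ ∞ φ → HasCompactSupport φ → tsupport φ ⊆ Om →
      ∫ z, x.1 z * fderiv ℝ φ z (1, 0) ∂area = - ∫ z, x.2.1 z * φ z ∂area ∧
      ∫ z, x.1 z * fderiv ℝ φ z (0, 1) ∂area = - ∫ z, x.2.2.1 z * φ z ∂area from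
    ⟨⟨(Lp.memLp _).locallyIntegrableOn_Om, (Lp.memLp _).locallyIntegrableOn_Om,
      fun φ h1 h2 h3 => (H φ h1 h2 h3).1⟩,
      ⟨(Lp.memLp _).locallyIntegrableOn_Om, (Lp.memLp _).locallyIntegrableOn_Om,
      fun φ h1 h2 h3 => (H φ h1 h2 h3).2⟩⟩
  intro φ h1 h2 h3
  have hφ1 : ContDiff ℝ 1 φ := h1.of_le (by exact_mod_cast le_top)
  have m0 : MemLp φ 2 area := memLp_of_continuous ae_area_mem_clOm h1.continuous 2
  have m1 := fun e => memLp_of_continuous ae_area_mem_clOm (continuous_fderiv_apply hφ1 e) 2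
  refine Jets.induction (p := fun x : X =>
      ∫ z, x.1 z * fderiv ℝ φ z (1, 0) ∂area = - ∫ z, x.2.1 z * φ z ∂area ∧
      ∫ z, x.1 z * fderiv ℝ φ z (0, 1) ∂area = - ∫ z, x.2.2.1 z * φ z ∂area) ?_ ?_ hx
  · simp only [integral_mul_toLp m0, integral_mul_toLp (m1 (1, 0)), integral_mul_toLp (m1 (0, 1))]
    refine IsClosed.inter (isClosed_eq ?_ ?_) (isClosed_eq ?_ ?_) <;> fun_prop
  · intro y v hv
    refine ⟨?_, ?_⟩
    · exact ((hasWeakDeriv_fderiv hv.contDiff (1, 0)).congr hv.val.symm hv.dx.symm).2.2 φ h1 h2 h3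
    · exact ((hasWeakDeriv_fderiv hv.contDiff (0, 1)).congr hv.val.symm hv.dy.symm).2.2 φ h1 h2 h3

/-- The quadruple `x` represents the function `u` with trace `g`. -/
structure Represents (x : X) (u g : ℝ × ℝ → ℝ) : Prop where
  mem : x ∈ Jets
  val : x.1 =ᵐ[area] u
  bd : x.2.2.2 =ᵐ[arcLength] g

namespace Represents

variable {x y : X} {u g u' g' : ℝ × ℝ → ℝ}

theorem hasWeakDeriv_x (h : Represents x u g) : HasWeakDeriv (1, 0) u x.2.1 :=
  (Jets.hasWeakDeriv_aux h.mem).1.congr h.val .rfl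

theorem hasWeakDeriv_y (h : Represents x u g) : HasWeakDeriv (0, 1) u x.2.2.1 :=
  (Jets.hasWeakDeriv_aux h.mem).2.congr h.val .rfl

theorem memH1 (h : Represents x u g) : MemH1 u :=
  ⟨(memLp_congr_ae h.val).1 (Lp.memLp _), ⟨_, h.hasWeakDeriv_x, Lp.memLp _⟩,
    ⟨_, h.hasWeakDeriv_y, Lp.memLp _⟩⟩

theorem add (h : Represents x u g) (h' : Represents y u' g') :
    Represents (x + y) (u + u') (g + g') :=
  ⟨add_mem h.mem h'.mem, (Lp.coeFn_add x.1 y.1).trans (h.val.add h'.val),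
    (Lp.coeFn_add x.2.2.2 y.2.2.2).trans (h.bd.add h'.bd)⟩

theorem smul (c : ℝ) (h : Represents x u g) : Represents (c • x) (c • u) (c • g) :=
  ⟨Jets.smul_mem c h.mem, (Lp.coeFn_smul c x.1).trans (h.val.const_smul c),
    (Lp.coeFn_smul c x.2.2.2).trans (h.bd.const_smul c)⟩

/-- Convergence in `X` is precisely the four `L²` convergences demanded by `HasTrace`. The converse
is `exists_represents`. -/
theorem hasTrace (h : Represents x u g) : HasTrace u g := by
  obtain ⟨y, v, hv, hlim⟩ := Jets.exists_seq h.mem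
  have conv : ∀ {μ : Measure (ℝ × ℝ)} {a : ℕ → Lp ℝ 2 μ} {b : Lp ℝ 2 μ}
      {f : ℕ → ℝ × ℝ → ℝ} {w : ℝ × ℝ → ℝ}, Tendsto a atTop (𝓝 b) → (∀ n, a n =ᵐ[μ] f n) →
      b =ᵐ[μ] w → Tendsto (fun n => eLpNorm (fun z => f n z - w z) 2 μ) atTop (𝓝 0) := by
    intro μ a b f w hab hf hw
    refine ((Lp.tendsto_Lp_iff_tendsto_eLpNorm' a b).1 hab).congr fun n => eLpNorm_congr_ae ?_
    exact (hf n).sub hw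
  refine ⟨v, fun n => (hv n).contDiff, ?_, ?_, ?_, ?_⟩
  · exact conv (hlim.fst_nhds) (fun n => (hv n).val) h.val
  · exact conv (hlim.snd_nhds.fst_nhds) (fun n => (hv n).dx) h.hasWeakDeriv_x.weakDeriv_ae_eq.symm
  · exact conv (hlim.snd_nhds.snd_nhds.fst_nhds) (fun n => (hv n).dy)
      h.hasWeakDeriv_y.weakDeriv_ae_eq.symm
  · exact conv (hlim.snd_nhds.snd_nhds.snd_nhds) (fun n => (hv n).bd) h.bd

end Represents

theorem tendsto_toLp_of_tendsto_eLpNorm {μ : Measure (ℝ × ℝ)} {a : ℕ → Lp ℝ 2 μ}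
    {f : ℕ → ℝ × ℝ → ℝ} {w w' : ℝ × ℝ → ℝ} (hw : MemLp w 2 μ) (hf : ∀ n, a n =ᵐ[μ] f n)
    (hww : w' =ᵐ[μ] w) (ht : Tendsto (fun n => eLpNorm (fun z => f n z - w' z) 2 μ) atTop (𝓝 0)) :
    Tendsto a atTop (𝓝 (hw.toLp w)) := by
  refine (Lp.tendsto_Lp_iff_tendsto_eLpNorm' a _).2 (ht.congr fun n => eLpNorm_congr_ae ?_)
  exact ((hf n).sub (hw.coeFn_toLp.trans hww.symm)).symm

theorem exists_represents {u g : ℝ × ℝ → ℝ} (hu : MemH1 u) (hg : MemLp g 2 arcLength)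
    (h : HasTrace u g) : ∃ x, Represents x u g := by
  obtain ⟨mu, ⟨p, hp, mp⟩, ⟨q, hq, mq⟩⟩ := hu
  obtain ⟨v, hv, c0, c1, c2, c3⟩ := h
  choose y hy using fun n => exists_isC1Jet (hv n)
  refine ⟨(mu.toLp, mp.toLp, mq.toLp, hg.toLp), ?_, mu.coeFn_toLp, hg.coeFn_toLp⟩
  refine isClosed_Jets.mem_of_tendsto (f := y) (b := atTop) ?_ (.of_forall fun n => (hy n).mem)
  refine (tendsto_toLp_of_tendsto_eLpNorm mu (fun n => (hy n).val) .rfl c0).prodMk_nhds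
    ((tendsto_toLp_of_tendsto_eLpNorm mp (fun n => (hy n).dx) hp.weakDeriv_ae_eq c1).prodMk_nhds
      ((tendsto_toLp_of_tendsto_eLpNorm mq (fun n => (hy n).dy) hq.weakDeriv_ae_eq c2).prodMk_nhds
        (tendsto_toLp_of_tendsto_eLpNorm hg (fun n => (hy n).bd) .rfl c3)))

/-! ### One-dimensional estimates -/

section OneDim

variable {w w' : ℝ → ℝ}

theorem sq_le_sq_add_integral (hw : ∀ t, HasDerivAt w (w' t) t) (hw' : Continuous w') {s y : ℝ}
    (hs : s ∈ Icc (-1 : ℝ) 1) (hy : y ∈ Icc (-1 : ℝ) 1) :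
    w y ^ 2 ≤ w s ^ 2 + ∫ t in (-1 : ℝ)..1, |2 * w t * w' t| := by
  have cw : Continuous w := continuous_iff_continuousAt.2 fun t => (hw t).continuousAt
  have cg : Continuous fun t => 2 * w t * w' t := by fun_prop
  have ftc : ∫ t in s..y, 2 * w t * w' t = w y ^ 2 - w s ^ 2 :=
    intervalIntegral.integral_eq_sub_of_hasDerivAt (f := fun t => w t ^ 2)
      (fun t _ => by simpa using! (hw t).pow 2) (cg.intervalIntegrable _ _)
  have hsub : uIoc s y ⊆ Ioc (-1) 1 := by
    rw [uIoc]
    exact Ioc_subset_Ioc (le_min hs.1 hy.1) (max_le hs.2 hy.2)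
  have b1 : |∫ t in s..y, 2 * w t * w' t| ≤ ∫ t in uIoc s y, |2 * w t * w' t| := by
    simpa only [Real.norm_eq_abs] using
      intervalIntegral.norm_integral_le_integral_norm_uIoc (f := fun t => 2 * w t * w' t)
  have b2 : ∫ t in uIoc s y, |2 * w t * w' t| ≤ ∫ t in (-1 : ℝ)..1, |2 * w t * w' t| := by
    rw [intervalIntegral.integral_of_le (by norm_num)]
    exact setIntegral_mono_set (cg.abs.integrableOn_Ioc)
      (.of_forall fun t => abs_nonneg _) hsub.eventuallyLE
  rw [ftc] at b1
  linarith [le_abs_self (w y ^ 2 - w s ^ 2)]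

/-- Average `sq_le_sq_add_integral` over the base point `s` and use `|2ww'| ≤ w² + w'²`. -/
theorem sq_le_integral (hw : ∀ t, HasDerivAt w (w' t) t) (hw' : Continuous w') {y : ℝ}
    (hy : y ∈ Icc (-1 : ℝ) 1) :
    w y ^ 2 ≤ ∫ t in (-1 : ℝ)..1, 2 * (w t ^ 2 + w' t ^ 2) := by
  have cw : Continuous w := continuous_iff_continuousAt.2 fun t => (hw t).continuousAt
  set J := ∫ t in (-1 : ℝ)..1, |2 * w t * w' t| with hJ
  have h1 : ∫ _ in (-1 : ℝ)..1, w y ^ 2 ≤ ∫ s in (-1 : ℝ)..1, (w s ^ 2 + J) := by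
    refine intervalIntegral.integral_mono_on (by norm_num) (by simp)
      (Continuous.intervalIntegrable (by fun_prop) _ _) fun s hs => ?_
    exact sq_le_sq_add_integral hw hw' hs hy
  have h2 : J ≤ ∫ t in (-1 : ℝ)..1, (w t ^ 2 + w' t ^ 2) := by
    refine intervalIntegral.integral_mono_on (by norm_num)
      (Continuous.intervalIntegrable (by fun_prop) _ _)
      (Continuous.intervalIntegrable (by fun_prop) _ _) fun s hs => ?_
    rw [abs_le]
    constructor <;> nlinarith [sq_nonneg (w s + w' s), sq_nonneg (w s - w' s)]
  have h3 : 0 ≤ ∫ t in (-1 : ℝ)..1, w' t ^ 2 :=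
    intervalIntegral.integral_nonneg (by norm_num) fun t _ => sq_nonneg _
  have h4 : 0 ≤ ∫ t in (-1 : ℝ)..1, w t ^ 2 :=
    intervalIntegral.integral_nonneg (by norm_num) fun t _ => sq_nonneg _
  have i1 : IntervalIntegrable (fun t => w t ^ 2) volume (-1) 1 :=
    Continuous.intervalIntegrable (by fun_prop) _ _
  have i2 : IntervalIntegrable (fun t => w' t ^ 2) volume (-1) 1 :=
    Continuous.intervalIntegrable (by fun_prop) _ _
  rw [intervalIntegral.integral_add i1 (by simp)] at h1
  rw [intervalIntegral.integral_add i1 i2] at h2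
  rw [intervalIntegral.integral_const_mul, intervalIntegral.integral_add i1 i2]
  simp only [intervalIntegral.integral_const, smul_eq_mul] at h1
  linarith

/-- Take the base point `-1` and integrate over the interval of length 2. The weighted bound `|2ww'|
≤ w²/4 + 4w'²` leaves `½∫w² ≤ 2w(-1)² + 8∫w'²`. The resulting 16 is what fixes the threshold `κ <
1/16`. -/
theorem integral_sq_le (hw : ∀ t, HasDerivAt w (w' t) t) (hw' : Continuous w') :
    ∫ t in (-1 : ℝ)..1, w t ^ 2 ≤ 4 * w (-1) ^ 2 + 16 * ∫ t in (-1 : ℝ)..1, w' t ^ 2 := by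
  have cw : Continuous w := continuous_iff_continuousAt.2 fun t => (hw t).continuousAt
  set J := ∫ t in (-1 : ℝ)..1, |2 * w t * w' t| with hJ
  have h1 : ∫ s in (-1 : ℝ)..1, w s ^ 2 ≤ ∫ _ in (-1 : ℝ)..1, (w (-1) ^ 2 + J) := by
    refine intervalIntegral.integral_mono_on (by norm_num)
      (Continuous.intervalIntegrable (by fun_prop) _ _) (by simp) fun s hs => ?_
    exact sq_le_sq_add_integral hw hw' (by norm_num) hs
  have h2 : J ≤ ∫ t in (-1 : ℝ)..1, (1 / 4 * w t ^ 2 + 4 * w' t ^ 2) := by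
    refine intervalIntegral.integral_mono_on (by norm_num)
      (Continuous.intervalIntegrable (by fun_prop) _ _)
      (Continuous.intervalIntegrable (by fun_prop) _ _) fun s hs => ?_
    rw [abs_le]
    constructor <;> nlinarith [sq_nonneg (w s / 2 + 2 * w' s), sq_nonneg (w s / 2 - 2 * w' s)]
  have i1 : IntervalIntegrable (fun t => 1 / 4 * w t ^ 2) volume (-1) 1 :=
    Continuous.intervalIntegrable (by fun_prop) _ _
  have i2 : IntervalIntegrable (fun t => 4 * w' t ^ 2) volume (-1) 1 :=
    Continuous.intervalIntegrable (by fun_prop) _ _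
  rw [intervalIntegral.integral_add i1 i2, intervalIntegral.integral_const_mul,
    intervalIntegral.integral_const_mul] at h2
  simp only [intervalIntegral.integral_const, smul_eq_mul] at h1
  linarith

end OneDim

/-! ### Iterated integrals over the square -/

theorem area_eq_prod :
    area = (volume.restrict (Ioo (-1 : ℝ) 1)).prod (volume.restrict (Ioo (-1 : ℝ) 1)) := by
  rw [Measure.prod_restrict, area, Om, Measure.volume_eq_prod]

theorem integral_Ioo_eq (f : ℝ → ℝ) : ∫ t in Ioo (-1 : ℝ) 1, f t = ∫ t in (-1 : ℝ)..1, f t := by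
  rw [intervalIntegral.integral_of_le (by norm_num), integral_Ioc_eq_integral_Ioo]

theorem integrable_area {f : ℝ × ℝ → ℝ} (hf : Continuous f) : Integrable f area :=
  memLp_one_iff_integrable.1 (memLp_of_continuous ae_area_mem_clOm hf 1)

theorem integral_area {f : ℝ × ℝ → ℝ} (hf : Continuous f) :
    ∫ z, f z ∂area = ∫ x in (-1 : ℝ)..1, ∫ y in (-1 : ℝ)..1, f (x, y) := by
  have h := integrable_area hf
  rw [area_eq_prod] at h ⊢
  rw [integral_prod f h]
  simp only [integral_Ioo_eq]

theorem integral_area_symm {f : ℝ × ℝ → ℝ} (hf : Continuous f) :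
    ∫ z, f z ∂area = ∫ y in (-1 : ℝ)..1, ∫ x in (-1 : ℝ)..1, f (x, y) := by
  have h := integrable_area hf
  rw [area_eq_prod] at h ⊢
  rw [integral_prod_symm f h]
  simp only [integral_Ioo_eq]

theorem integral_bottom_le_integral_arcLength {f : ℝ × ℝ → ℝ} (hf : Continuous f)
    (h0 : ∀ z, 0 ≤ f z) : ∫ x in (-1 : ℝ)..1, f (x, -1) ≤ ∫ z, f z ∂arcLength := by
  have hi : Integrable f arcLength :=
    memLp_one_iff_integrable.1 (memLp_of_continuous ae_arcLength_mem_clOm hf 1)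
  have h1 : ∫ z, f z ∂((volume.restrict (Icc (-1 : ℝ) 1)).map (fun t => (t, (-1 : ℝ)))) ≤
      ∫ z, f z ∂arcLength :=
    integral_mono_measure (Measure.le_add_left le_rfl) (.of_forall h0) hi
  rw [integral_map (by fun_prop) hf.aestronglyMeasurable, integral_Icc_eq_integral_Ioc,
    ← intervalIntegral.integral_of_le (by norm_num)] at h1
  exact h1

theorem hasDerivAt_slice_x {v : ℝ × ℝ → ℝ} (hv : ContDiff ℝ 1 v) (y t : ℝ) :
    HasDerivAt (fun x => v (x, y)) (fderiv ℝ v (t, y) (1, 0)) t :=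
  ((hv.differentiable one_ne_zero (t, y)).hasFDerivAt.comp_hasDerivAt t
    ((hasDerivAt_id t).prodMk (hasDerivAt_const t y)))

theorem hasDerivAt_slice_y {v : ℝ × ℝ → ℝ} (hv : ContDiff ℝ 1 v) (x t : ℝ) :
    HasDerivAt (fun y => v (x, y)) (fderiv ℝ v (x, t) (0, 1)) t :=
  ((hv.differentiable one_ne_zero (x, t)).hasFDerivAt.comp_hasDerivAt t
    ((hasDerivAt_const t x).prodMk (hasDerivAt_id t)))

theorem norm_sq_eq_integral {μ : Measure (ℝ × ℝ)} (u : Lp ℝ 2 μ) {f : ℝ × ℝ → ℝ}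
    (h : u =ᵐ[μ] f) : ‖u‖ ^ 2 = ∫ z, f z ^ 2 ∂μ := by
  rw [← real_inner_self_eq_norm_sq, L2.inner_def]
  refine integral_congr_ae (h.mono fun z hz => ?_)
  simp only [hz]
  simp [sq]

/-! ### Poincaré inequality -/

/-- The one-dimensional bound on each vertical segment, started from the bottom edge and integrated
in `x`; the bottom edge is only part of the boundary norm. -/
theorem IsC1Jet.poincare {x : X} {v : ℝ × ℝ → ℝ} (h : IsC1Jet x v) :
    ‖x.1‖ ^ 2 ≤ 4 * ‖x.2.2.2‖ ^ 2 + 16 * ‖x.2.2.1‖ ^ 2 := by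
  have c := h.contDiff.continuous
  have cy := continuous_fderiv_apply h.contDiff (0, 1)
  rw [norm_sq_eq_integral _ h.val, norm_sq_eq_integral _ h.dy, norm_sq_eq_integral _ h.bd,
    integral_area (by fun_prop), integral_area (by fun_prop)]
  have b := integral_bottom_le_integral_arcLength (f := fun z => v z ^ 2) (by fun_prop)
    fun z => sq_nonneg _
  have c1 : Continuous fun a => ∫ y in (-1 : ℝ)..1, v (a, y) ^ 2 :=
    intervalIntegral.continuous_parametric_intervalIntegral_of_continuous'
      (by simp only [Function.uncurry_def]; fun_prop) _ _
  have c2 : Continuous fun a => ∫ y in (-1 : ℝ)..1, (fderiv ℝ v (a, y) (0, 1)) ^ 2 :=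
    intervalIntegral.continuous_parametric_intervalIntegral_of_continuous'
      (by simp only [Function.uncurry_def]; exact cy.pow 2) _ _
  have i1 : IntervalIntegrable (fun a => 4 * v (a, -1) ^ 2) volume (-1) 1 :=
    Continuous.intervalIntegrable (by fun_prop) _ _
  have i2 : IntervalIntegrable
      (fun a => 16 * ∫ y in (-1 : ℝ)..1, (fderiv ℝ v (a, y) (0, 1)) ^ 2) volume (-1) 1 :=
    Continuous.intervalIntegrable (by fun_prop) _ _
  have m := intervalIntegral.integral_mono_on (μ := volume) (a := (-1 : ℝ)) (b := 1) (by norm_num)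
    (c1.intervalIntegrable _ _) (i1.add i2) fun a _ =>
      integral_sq_le (hasDerivAt_slice_y h.contDiff a) (cy.comp (by fun_prop))
  rw [intervalIntegral.integral_add i1 i2, intervalIntegral.integral_const_mul,
    intervalIntegral.integral_const_mul] at m
  linarith

theorem Jets.poincare {x : X} (hx : x ∈ Jets) :
    ‖x.1‖ ^ 2 ≤ 4 * ‖x.2.2.2‖ ^ 2 + 16 * ‖x.2.2.1‖ ^ 2 :=
  Jets.induction (p := fun x : X => ‖x.1‖ ^ 2 ≤ 4 * ‖x.2.2.2‖ ^ 2 + 16 * ‖x.2.2.1‖ ^ 2)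
    (isClosed_le (by fun_prop) (by fun_prop)) (fun _ _ h => h.poincare) hx

/-! ### The embedding into `L⁴` -/

/-- Ladyzhenskaya's argument: `v²` is bounded by a function `G` of `y` alone (horizontal slices) and
by a function `H` of `x` alone (vertical slices), so `v⁴ ≤ H(x) G(y)` and the double integral
factorises. -/
theorem IsC1Jet.integral_pow_four_le {x : X} {v : ℝ × ℝ → ℝ} (h : IsC1Jet x v) :
    ∫ z, v z ^ 4 ∂area ≤ (2 * ‖x‖) ^ 4 := by
  have c := h.contDiff.continuous
  have cx := continuous_fderiv_apply h.contDiff (1, 0)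
  have cy := continuous_fderiv_apply h.contDiff (0, 1)
  set G : ℝ → ℝ := fun y => ∫ s in (-1 : ℝ)..1, 2 * (v (s, y) ^ 2 + fderiv ℝ v (s, y) (1, 0) ^ 2)
    with hG
  set H : ℝ → ℝ := fun x => ∫ s in (-1 : ℝ)..1, 2 * (v (x, s) ^ 2 + fderiv ℝ v (x, s) (0, 1) ^ 2)
    with hH
  have cG : Continuous G := by
    refine intervalIntegral.continuous_parametric_intervalIntegral_of_continuous' ?_ _ _
    have h1 : Continuous fun z => 2 * (v z ^ 2 + fderiv ℝ v z (1, 0) ^ 2) := by fun_prop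
    exact h1.comp continuous_swap
  have cH : Continuous H := by
    refine intervalIntegral.continuous_parametric_intervalIntegral_of_continuous' ?_ _ _
    have h1 : Continuous fun z => 2 * (v z ^ 2 + fderiv ℝ v z (0, 1) ^ 2) := by fun_prop
    exact h1
  have iG : ∫ y in (-1 : ℝ)..1, G y = 2 * (‖x.1‖ ^ 2 + ‖x.2.1‖ ^ 2) := by
    rw [hG, ← integral_area_symm (f := fun z => 2 * (v z ^ 2 + fderiv ℝ v z (1, 0) ^ 2))
      (by fun_prop), integral_const_mul, integral_add (integrable_area (by fun_prop))
      (integrable_area (by fun_prop)), ← norm_sq_eq_integral _ h.val, ← norm_sq_eq_integral _ h.dx]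
  have iH : ∫ y in (-1 : ℝ)..1, H y = 2 * (‖x.1‖ ^ 2 + ‖x.2.2.1‖ ^ 2) := by
    rw [hH, ← integral_area (f := fun z => 2 * (v z ^ 2 + fderiv ℝ v z (0, 1) ^ 2))
      (by fun_prop), integral_const_mul, integral_add (integrable_area (by fun_prop))
      (integrable_area (by fun_prop)), ← norm_sq_eq_integral _ h.val, ← norm_sq_eq_integral _ h.dy]
  have le1 : ∫ z, v z ^ 4 ∂area ≤ ∫ z, H z.1 * G z.2 ∂area := by
    refine integral_mono_ae (integrable_area (by fun_prop)) (integrable_area (by fun_prop)) ?_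
    filter_upwards [ae_area_mem_clOm] with z hz
    have a1 : v z ^ 2 ≤ G z.2 := sq_le_integral (w := fun s => v (s, z.2))
      (hasDerivAt_slice_x h.contDiff z.2) (cx.comp (by fun_prop)) hz.1
    have a2 : v z ^ 2 ≤ H z.1 := sq_le_integral (w := fun s => v (z.1, s))
      (hasDerivAt_slice_y h.contDiff z.1) (cy.comp (by fun_prop)) hz.2
    calc v z ^ 4 = v z ^ 2 * v z ^ 2 := by ring
      _ ≤ H z.1 * G z.2 := mul_le_mul a2 a1 (sq_nonneg _) ((sq_nonneg _).trans a2)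
  have e1 : ∫ z, H z.1 * G z.2 ∂area =
      (2 * (‖x.1‖ ^ 2 + ‖x.2.2.1‖ ^ 2)) * (2 * (‖x.1‖ ^ 2 + ‖x.2.1‖ ^ 2)) := by
    rw [integral_area (by fun_prop), ← iG, ← iH]
    simp only [intervalIntegral.integral_const_mul, intervalIntegral.integral_mul_const]
  have n1 : ‖x.1‖ ^ 2 ≤ ‖x‖ ^ 2 := by gcongr; exact norm_fst_le x
  have n2 : ‖x.2.1‖ ^ 2 ≤ ‖x‖ ^ 2 := by
    gcongr; exact (norm_fst_le x.2).trans (norm_snd_le x)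
  have n3 : ‖x.2.2.1‖ ^ 2 ≤ ‖x‖ ^ 2 := by
    gcongr; exact (norm_fst_le x.2.2).trans ((norm_snd_le x.2).trans (norm_snd_le x))
  calc ∫ z, v z ^ 4 ∂area ≤ _ := le1.trans_eq e1
    _ ≤ (4 * ‖x‖ ^ 2) * (4 * ‖x‖ ^ 2) :=
      mul_le_mul (by linarith) (by linarith) (by positivity) (by positivity)
    _ = (2 * ‖x‖) ^ 4 := by ring

theorem IsC1Jet.eLpNorm_four_le {x : X} {v : ℝ × ℝ → ℝ} (h : IsC1Jet x v) :
    eLpNorm x.1 4 area ≤ ENNReal.ofReal (2 * ‖x‖) := by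
  have h4 : (4 : ENNReal).toReal = (4 : ℕ) := by norm_num
  rw [eLpNorm_congr_ae h.val, MemLp.eLpNorm_eq_integral_rpow_norm (by norm_num) (by norm_num)
    (memLp_of_continuous ae_area_mem_clOm h.contDiff.continuous 4)]
  refine ENNReal.ofReal_le_ofReal ?_
  simp only [h4, Real.rpow_natCast, Real.norm_eq_abs, Even.pow_abs (by decide : Even 4)]
  rw [← Real.pow_rpow_inv_natCast (x := 2 * ‖x‖) (by positivity) (by norm_num : (4 : ℕ) ≠ 0)]
  refine Real.rpow_le_rpow (integral_nonneg fun z => by positivity) h.integral_pow_four_le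
    (by positivity)

/-- Fatou along an almost everywhere convergent subsequence of `C¹` approximants. -/
theorem Jets.eLpNorm_four_le {x : X} (hx : x ∈ Jets) :
    eLpNorm x.1 4 area ≤ ENNReal.ofReal (2 * ‖x‖) := by
  obtain ⟨y, v, hv, hlim⟩ := Jets.exists_seq hx
  have hm := tendstoInMeasure_of_tendsto_eLpNorm (μ := area) two_ne_zero
    (fun n => (Lp.aestronglyMeasurable (y n).1)) (Lp.aestronglyMeasurable x.1)
    ((Lp.tendsto_Lp_iff_tendsto_eLpNorm' _ _).1 hlim.fst_nhds)
  obtain ⟨ns, hns, hae⟩ := hm.exists_seq_tendsto_ae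
  refine (Lp.eLpNorm_lim_le_liminf_eLpNorm (p := 4)
    (fun n => Lp.aestronglyMeasurable (y (ns n)).1) _ hae).trans ?_
  have ht : Tendsto (fun n => ENNReal.ofReal (2 * ‖y (ns n)‖)) atTop
      (𝓝 (ENNReal.ofReal (2 * ‖x‖))) :=
    ENNReal.tendsto_ofReal (((hlim.comp hns.tendsto_atTop).norm).const_mul 2)
  rw [← ht.liminf_eq]
  exact liminf_le_liminf (.of_forall fun n => (hv (ns n)).eLpNorm_four_le)

theorem Jets.memLp_four {x : X} (hx : x ∈ Jets) : MemLp x.1 4 area :=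
  ⟨Lp.aestronglyMeasurable _, (Jets.eLpNorm_four_le hx).trans_lt ENNReal.ofReal_lt_top⟩

instance : Fact ((1 : ENNReal) ≤ 4) := ⟨by norm_num⟩

/-- The embedding of `H¹` into `L⁴`. -/
def toL4 : Jets →L[ℝ] Lp ℝ 4 area :=
  LinearMap.mkContinuous
    { toFun := fun x => (Jets.memLp_four x.2).toLp
      map_add' := fun x y => by
        rw [← MemLp.toLp_add]
        exact MemLp.toLp_congr _ _ (Lp.coeFn_add _ _)
      map_smul' := fun c x => by
        rw [RingHom.id_apply, ← MemLp.toLp_const_smul]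
        exact MemLp.toLp_congr _ _ (Lp.coeFn_smul _ _) } 2 fun x => by
    refine (Lp.norm_toLp _ (Jets.memLp_four x.2)).trans_le
      (ENNReal.toReal_le_of_le_ofReal (by positivity) ?_)
    exact Jets.eLpNorm_four_le x.2

theorem coeFn_toL4 (x : Jets) : toL4 x =ᵐ[area] (x : X).1 :=
  (Jets.memLp_four x.2).coeFn_toLp

instance : ENNReal.HolderTriple 4 4 2 := by
  refine ⟨?_⟩
  rw [show (4 : ENNReal) = 2 * 2 by norm_num, ENNReal.mul_inv (by simp) (by simp), ← mul_add,
    ENNReal.inv_two_add_inv_two, mul_one]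

/-- The product of two `H¹` functions, in `L²`. -/
def prodL2 (x y : Jets) : Lp ℝ 2 area :=
  (ContinuousLinearMap.mul ℝ ℝ).holderL area 4 4 2 (toL4 x) (toL4 y)

theorem coeFn_prodL2 (x y : Jets) : prodL2 x y =ᵐ[area] fun z => (x : X).1 z * (y : X).1 z := by
  filter_upwards [(ContinuousLinearMap.mul ℝ ℝ).coeFn_holder (r := 2) (toL4 x) (toL4 y),
    coeFn_toL4 x, coeFn_toL4 y] with z h1 h2 h3
  rw [← h2, ← h3]
  exact h1

/-! ### Minimisation of uniformly convex functionals -/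

/-- Near-minimisers are close together: their midpoint cannot go below the infimum, so the quadratic
gain forces a minimising sequence to be Cauchy, and completeness supplies the limit. -/
theorem exists_forall_le_of_midpoint {E : Type*} [NormedAddCommGroup E] [CompleteSpace E]
    {K : Set E} (hK : IsClosed K) (hne : K.Nonempty) {F : E → ℝ} (hF : Continuous F) {m₀ c : ℝ}
    (hbd : ∀ x ∈ K, m₀ ≤ F x) (hc : 0 < c)
    (hmid : ∀ a ∈ K, ∀ b ∈ K, ∃ m ∈ K, 2 * F m + c * ‖a - b‖ ^ 2 ≤ F a + F b) :
    ∃ x ∈ K, ∀ y ∈ K, F x ≤ F y := by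
  have hb : BddBelow (F '' K) := ⟨m₀, by rintro _ ⟨x, hx, rfl⟩; exact hbd x hx⟩
  obtain ⟨s, -, hs, hmem⟩ := exists_seq_tendsto_sInf (hne.image F) hb
  choose x hx hxs using hmem
  have hinf : ∀ y ∈ K, sInf (F '' K) ≤ F y := fun y hy => csInf_le hb ⟨y, hy, rfl⟩
  have hcau : CauchySeq x := by
    refine Metric.cauchySeq_iff.2 fun ε hε => ?_
    -- Two values within `cε²/2` of the infimum give `c‖a - b‖² < cε²` in the midpoint inequality.
    have hev := hs.eventually (gt_mem_nhds
      (show sInf (F '' K) < sInf (F '' K) + c * ε ^ 2 / 2 by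
        have : 0 < c * ε ^ 2 / 2 := by positivity
        linarith))
    obtain ⟨N, hN⟩ := eventually_atTop.1 hev
    refine ⟨N, fun i hi j hj => ?_⟩
    obtain ⟨m, hm, hle⟩ := hmid (x i) (hx i) (x j) (hx j)
    have h1 := hN i hi
    have h2 := hN j hj
    rw [← hxs] at h1 h2
    have h3 := hinf m hm
    rw [dist_eq_norm]
    refine lt_of_pow_lt_pow_left₀ 2 hε.le (lt_of_mul_lt_mul_left ?_ hc.le)
    linarith
  obtain ⟨z, hz⟩ := cauchySeq_tendsto_of_complete hcau
  refine ⟨z, hK.mem_of_tendsto hz (.of_forall hx), fun y hy => ?_⟩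
  have h1 : Tendsto (fun n => F (x n)) atTop (𝓝 (F z)) := (hF.tendsto z).comp hz
  simp only [hxs] at h1
  rw [tendsto_nhds_unique h1 hs]
  exact hinf y hy

/-! ### The functional in terms of jets -/

instance : CompleteSpace Jets := isClosed_Jets.completeSpace_coe

theorem prodL2_add_left (x x' y : Jets) : prodL2 (x + x') y = prodL2 x y + prodL2 x' y := by
  simp only [prodL2, map_add, add_apply]

theorem prodL2_comm (x y : Jets) : prodL2 x y = prodL2 y x := by
  refine Lp.ext ?_
  filter_upwards [coeFn_prodL2 x y, coeFn_prodL2 y x] with z h1 h2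
  rw [h1, h2, mul_comm]

theorem prodL2_add_right (x y y' : Jets) : prodL2 x (y + y') = prodL2 x y + prodL2 x y' := by
  rw [prodL2_comm, prodL2_add_left, prodL2_comm y, prodL2_comm y']

theorem prodL2_smul_left (c : ℝ) (x y : Jets) : prodL2 (c • x) y = c • prodL2 x y := by
  simp only [prodL2, map_smul, smul_apply]

theorem prodL2_smul_right (c : ℝ) (x y : Jets) : prodL2 x (c • y) = c • prodL2 x y := by
  rw [prodL2_comm, prodL2_smul_left, prodL2_comm]

theorem prodL2_zero : prodL2 0 0 = 0 := by
  simp [prodL2]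

theorem continuous_prodL2_self : Continuous fun x : Jets => prodL2 x x := by
  unfold prodL2
  fun_prop

/-- The integrand is `u²w² ≥ 0`. This positivity is the source of every convexity property of the
quartic term. -/
theorem inner_prodL2_nonneg (x y : Jets) : 0 ≤ inner ℝ (prodL2 x x) (prodL2 y y) := by
  rw [L2.inner_def]
  refine integral_nonneg_of_ae ?_
  filter_upwards [coeFn_prodL2 x x, coeFn_prodL2 y y] with z h1 h2
  simp only [h1, h2, Pi.zero_apply, RCLike.inner_apply, conj_trivial]
  exact mul_nonneg (mul_self_nonneg _) (mul_self_nonneg _)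

/-- The bilinear form `∫ α u_x w_x + u_y w_y - κ u w`. -/
def bilin (α κ : ℝ) (x y : Jets) : ℝ :=
  α * inner ℝ (x : X).2.1 (y : X).2.1 + inner ℝ (x : X).2.2.1 (y : X).2.2.1
    - κ * inner ℝ (x : X).1 (y : X).1

theorem bilin_add_left (α κ : ℝ) (x x' y : Jets) :
    bilin α κ (x + x') y = bilin α κ x y + bilin α κ x' y := by
  simp only [bilin, Submodule.coe_add, Prod.fst_add, Prod.snd_add, inner_add_left]
  ring

theorem bilin_comm (α κ : ℝ) (x y : Jets) : bilin α κ x y = bilin α κ y x := by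
  simp only [bilin]
  rw [real_inner_comm, real_inner_comm (x : X).2.2.1, real_inner_comm (x : X).1]

theorem bilin_add_right (α κ : ℝ) (x y y' : Jets) :
    bilin α κ x (y + y') = bilin α κ x y + bilin α κ x y' := by
  rw [bilin_comm, bilin_add_left, bilin_comm α κ y, bilin_comm α κ y']

theorem bilin_smul_left (α κ c : ℝ) (x y : Jets) :
    bilin α κ (c • x) y = c * bilin α κ x y := by
  simp only [bilin, Submodule.coe_smul, Prod.smul_fst, Prod.smul_snd, real_inner_smul_left]
  ring

theorem bilin_smul_right (α κ c : ℝ) (x y : Jets) :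
    bilin α κ x (c • y) = c * bilin α κ x y := by
  rw [bilin_comm, bilin_smul_left, bilin_comm]

theorem bilin_self (α κ : ℝ) (x : Jets) : bilin α κ x x =
    α * ‖(x : X).2.1‖ ^ 2 + ‖(x : X).2.2.1‖ ^ 2 - κ * ‖(x : X).1‖ ^ 2 := by
  simp only [bilin, real_inner_self_eq_norm_sq]

/-- Poincaré lets `u_y` absorb `κu²`, leaving only a trace term; this bounds the energy below on
maps with prescribed trace. -/
theorem bilin_self_ge {α κ : ℝ} (hα : 0 ≤ α) (hκ : 0 ≤ κ) (hκ' : κ ≤ 1 / 16) (x : Jets) :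
    -(4 * κ) * ‖(x : X).2.2.2‖ ^ 2 ≤ bilin α κ x x := by
  rw [bilin_self]
  have h := Jets.poincare x.2
  have h1 := mul_le_mul_of_nonneg_left h hκ
  have h2 : 0 ≤ α * ‖(x : X).2.1‖ ^ 2 := by positivity
  have h3 : κ * ‖(x : X).2.2.1‖ ^ 2 ≤ 1 / 16 * ‖(x : X).2.2.1‖ ^ 2 := by gcongr
  linarith

/-- The jets with vanishing trace. -/
def Jets₀ : Set Jets := {x | (x : X).2.2.2 = 0}

theorem bilin_self_nonneg {α κ : ℝ} (hα : 0 ≤ α) (hκ : 0 ≤ κ) (hκ' : κ ≤ 1 / 16) {x : Jets}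
    (hx : x ∈ Jets₀) : 0 ≤ bilin α κ x x := by
  have h := bilin_self_ge hα hκ hκ' x
  rw [show (x : X).2.2.2 = 0 from hx, norm_zero] at h
  linarith

theorem bilin_coercive {α κ : ℝ} (hα : 0 < α) (hκ : 0 ≤ κ) (hκ' : κ < 1 / 16) :
    ∃ c > 0, ∀ x ∈ Jets₀, c * ‖x‖ ^ 2 ≤ bilin α κ x x := by
  -- After Poincaré, `(1 - 16κ)‖u_y‖²` survives. Half of it controls `c‖u‖²`, since `‖u‖² ≤
  -- 16‖u_y‖²`, and a further 1/32 controls `c‖u_y‖²`.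
  set c := min α ((1 - 16 * κ) / 32) with hc
  have c1 : c ≤ α := min_le_left _ _
  have c2 : c ≤ (1 - 16 * κ) / 32 := min_le_right _ _
  have c0 : 0 < c := lt_min hα (by linarith)
  refine ⟨c, c0, fun x hx => ?_⟩
  rw [bilin_self]
  have hx0 : (x : X).2.2.2 = 0 := hx
  have h := Jets.poincare x.2
  rw [hx0, norm_zero] at h
  have hn : ‖x‖ ^ 2 ≤ ‖(x : X).1‖ ^ 2 + ‖(x : X).2.1‖ ^ 2 + ‖(x : X).2.2.1‖ ^ 2 := by
    have : ‖x‖ = max ‖(x : X).1‖ (max ‖(x : X).2.1‖ (max ‖(x : X).2.2.1‖ ‖(x : X).2.2.2‖)) := rfl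
    rw [this, hx0, norm_zero, max_eq_left (norm_nonneg _)]
    rcases max_choice ‖(x : X).1‖ (max ‖(x : X).2.1‖ ‖(x : X).2.2.1‖) with h1 | h1
    · rw [h1]; nlinarith [norm_nonneg (x : X).2.1, norm_nonneg (x : X).2.2.1]
    · rw [h1]
      rcases max_choice ‖(x : X).2.1‖ ‖(x : X).2.2.1‖ with h2 | h2 <;> rw [h2] <;>
        nlinarith [norm_nonneg (x : X).2.1, norm_nonneg (x : X).2.2.1, norm_nonneg (x : X).1]
  have k1 : κ * ‖(x : X).1‖ ^ 2 ≤ κ * (16 * ‖(x : X).2.2.1‖ ^ 2) := by gcongr; linarith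
  have k2 : c * ‖(x : X).2.1‖ ^ 2 ≤ α * ‖(x : X).2.1‖ ^ 2 := by gcongr
  have k3 : c * ‖(x : X).1‖ ^ 2 ≤ (1 - 16 * κ) / 32 * (16 * ‖(x : X).2.2.1‖ ^ 2) :=
    mul_le_mul c2 (by linarith) (by positivity) (by linarith)
  have k4 : c * ‖(x : X).2.2.1‖ ^ 2 ≤ (1 - 16 * κ) / 32 * ‖(x : X).2.2.1‖ ^ 2 := by gcongr
  have k5 : 0 ≤ (1 - 16 * κ) * ‖(x : X).2.2.1‖ ^ 2 := mul_nonneg (by linarith) (sq_nonneg _)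
  have k6 := mul_le_mul_of_nonneg_left hn c0.le
  linarith

/-- The energy of the map with entries `P₁₁ = u` and `P₁₂ = w`. -/
def jetEnergy (α κ μ : ℝ) (x y : Jets) : ℝ :=
  bilin α κ x x + bilin α κ y y + μ * ‖prodL2 x x + prodL2 y y‖ ^ 2

/-- The first variation of `jetEnergy` at `(x, y)` in the direction `(a, b)`. -/
def firstVariation (α κ μ : ℝ) (x y a b : Jets) : ℝ :=
  2 * (bilin α κ x a + bilin α κ y b)
    + 4 * μ * inner ℝ (prodL2 x x + prodL2 y y) (prodL2 x a + prodL2 y b)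

/-- Along a line the quadratic forms, and the `L²`-valued map `u² + w²`, are quadratic polynomials
in `t`, so no differentiation under the integral is required. -/
theorem hasDerivAt_jetEnergy (α κ μ : ℝ) (x y a b : Jets) :
    HasDerivAt (fun t : ℝ => jetEnergy α κ μ (x + t • a) (y + t • b))
      (firstVariation α κ μ x y a b) 0 := by
  have hq : ∀ x a : Jets, HasDerivAt (fun t : ℝ => bilin α κ (x + t • a) (x + t • a))
      (2 * bilin α κ x a) 0 := by
    intro x a
    have e : (fun t : ℝ => bilin α κ (x + t • a) (x + t • a)) =
        fun t => bilin α κ x x + 2 * bilin α κ x a * t + bilin α κ a a * t ^ 2 := by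
      funext t
      simp only [bilin_add_left, bilin_add_right, bilin_smul_left, bilin_smul_right,
        bilin_comm α κ a x]
      ring
    rw [e]
    have := (((hasDerivAt_id (0 : ℝ)).const_mul (2 * bilin α κ x a)).const_add
      (bilin α κ x x)).add (((hasDerivAt_id (0 : ℝ)).pow 2).const_mul (bilin α κ a a))
    simpa using! this
  have hB : HasDerivAt
      (fun t : ℝ => prodL2 (x + t • a) (x + t • a) + prodL2 (y + t • b) (y + t • b))
      ((2 : ℝ) • (prodL2 x a + prodL2 y b)) 0 := by
    have e : (fun t : ℝ => prodL2 (x + t • a) (x + t • a) + prodL2 (y + t • b) (y + t • b)) =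
        fun t => (prodL2 x x + prodL2 y y) + (2 * t) • (prodL2 x a + prodL2 y b)
          + (t ^ 2) • (prodL2 a a + prodL2 b b) := by
      funext t
      simp only [prodL2_add_left, prodL2_add_right, prodL2_smul_left, prodL2_smul_right,
        prodL2_comm a x, prodL2_comm b y]
      module
    rw [e]
    have := ((((hasDerivAt_id (0 : ℝ)).const_mul 2).smul_const
      (prodL2 x a + prodL2 y b)).const_add (prodL2 x x + prodL2 y y)).add
      (((hasDerivAt_id (0 : ℝ)).pow 2).smul_const (prodL2 a a + prodL2 b b))
    simpa using! this
  have hN := (hB.norm_sq).const_mul μ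
  refine (((hq x a).add (hq y b)).add hN).congr_deriv ?_
  simp only [firstVariation, zero_smul, add_zero, real_inner_smul_right]
  ring

theorem inner_add_prodL2_nonneg (x y a b : Jets) :
    0 ≤ inner ℝ (prodL2 x x + prodL2 y y) (prodL2 a a + prodL2 b b) := by
  simp only [inner_add_left, inner_add_right]
  have := inner_prodL2_nonneg x a
  have := inner_prodL2_nonneg x b
  have := inner_prodL2_nonneg y a
  have := inner_prodL2_nonneg y b
  positivity

/-- Strict monotonicity of the first variation. -/
theorem le_firstVariation_sub {α κ μ : ℝ} (hμ : 0 ≤ μ) (x y a b : Jets) :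
    2 * (bilin α κ a a + bilin α κ b b) ≤
      firstVariation α κ μ (x + a) (y + b) a b - firstVariation α κ μ x y a b := by
  set S := prodL2 x x + prodL2 y y with hS
  set M := prodL2 x a + prodL2 y b with hM
  set N := prodL2 a a + prodL2 b b with hN
  have eS : prodL2 (x + a) (x + a) + prodL2 (y + b) (y + b) = S + (2 : ℝ) • M + N := by
    simp only [hS, hM, hN, prodL2_add_left, prodL2_add_right, prodL2_comm a x, prodL2_comm b y]
    module
  have eM : prodL2 (x + a) a + prodL2 (y + b) b = M + N := by
    simp only [hM, hN, prodL2_add_left]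
    abel
  have p1 : 0 ≤ inner ℝ S N := inner_add_prodL2_nonneg x y a b
  have p2 : 0 ≤ inner ℝ (S + (2 : ℝ) • M + N) N := by
    rw [← eS]; exact inner_add_prodL2_nonneg _ _ _ _
  have p3 : 0 ≤ inner ℝ ((2 : ℝ) • M + N) ((2 : ℝ) • M + N) := real_inner_self_nonneg
  -- The left side expands to `⟨S,N⟩ + 2‖M‖² + 3⟨M,N⟩ + ‖N‖²`, which is half the sum of the
  -- quantities in `p1`, `p2`, `p3`.
  have key : 0 ≤ inner ℝ (S + (2 : ℝ) • M + N) (M + N) - inner ℝ S M := by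
    simp only [inner_add_left, inner_add_right, real_inner_smul_left, real_inner_smul_right,
      real_inner_comm M N] at p1 p2 p3 ⊢
    linarith
  have := mul_nonneg hμ key
  simp only [firstVariation, eS, eM, bilin_add_left]
  rw [← hS, ← hM]
  linarith

theorem eq_of_firstVariation_eq_zero {α κ μ : ℝ} (hα : 0 < α) (hκ : 0 ≤ κ) (hκ' : κ < 1 / 16)
    (hμ : 0 ≤ μ) {x y a b : Jets} (ha : a ∈ Jets₀) (hb : b ∈ Jets₀)
    (h0 : firstVariation α κ μ x y a b = 0) (h1 : firstVariation α κ μ (x + a) (y + b) a b = 0) :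
    a = 0 ∧ b = 0 := by
  obtain ⟨c, hc, hco⟩ := bilin_coercive hα hκ hκ'
  have h := le_firstVariation_sub (α := α) (κ := κ) hμ x y a b
  rw [h0, h1] at h
  have ha' := hco a ha
  have hb' := hco b hb
  have na : 0 ≤ c * ‖a‖ ^ 2 := by positivity
  have nb : 0 ≤ c * ‖b‖ ^ 2 := by positivity
  constructor
  · have : c * ‖a‖ ^ 2 = 0 := by linarith
    simpa [hc.ne'] using this
  · have : c * ‖b‖ ^ 2 = 0 := by linarith
    simpa [hc.ne'] using this

/-- Parallelogram law for the quadratic part. For the quartic part it gives `2‖m² + d²‖² + 8‖md‖²`,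
at least `2‖m²‖²` because `⟨m², d²⟩ ≥ 0`. -/
theorem jetEnergy_midpoint {α κ μ : ℝ} (hμ : 0 ≤ μ) (m d : Jets) :
    2 * jetEnergy α κ μ m 0 + 2 * bilin α κ d d ≤
      jetEnergy α κ μ (m + d) 0 + jetEnergy α κ μ (m - d) 0 := by
  have e1 : prodL2 (m + d) (m + d) = prodL2 m m + (2 : ℝ) • prodL2 m d + prodL2 d d := by
    simp only [prodL2_add_left, prodL2_add_right, prodL2_comm d m]
    module
  have e2 : prodL2 (m - d) (m - d) = prodL2 m m - (2 : ℝ) • prodL2 m d + prodL2 d d := by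
    rw [sub_eq_add_neg, ← neg_one_smul ℝ d]
    simp only [prodL2_add_left, prodL2_add_right, prodL2_smul_left, prodL2_smul_right,
      prodL2_comm d m]
    module
  have q1 : bilin α κ (m + d) (m + d) + bilin α κ (m - d) (m - d) =
      2 * bilin α κ m m + 2 * bilin α κ d d := by
    rw [sub_eq_add_neg, ← neg_one_smul ℝ d]
    simp only [bilin_add_left, bilin_add_right, bilin_smul_left, bilin_smul_right]
    ring
  have key : 2 * ‖prodL2 m m‖ ^ 2 ≤ ‖prodL2 (m + d) (m + d)‖ ^ 2
      + ‖prodL2 (m - d) (m - d)‖ ^ 2 := by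
    have p1 := inner_prodL2_nonneg m d
    have p2 : 0 ≤ inner ℝ (prodL2 d d) (prodL2 d d) := real_inner_self_nonneg
    have p3 : 0 ≤ inner ℝ (prodL2 m d) (prodL2 m d) := real_inner_self_nonneg
    rw [e1, e2]
    simp only [← real_inner_self_eq_norm_sq, inner_add_left, inner_add_right, inner_sub_left,
      inner_sub_right, real_inner_smul_left, real_inner_smul_right,
      real_inner_comm (prodL2 m m) (prodL2 d d)]
    linarith
  have := mul_le_mul_of_nonneg_left key hμ
  simp only [jetEnergy, prodL2_zero, add_zero]
  linarith

theorem continuous_jetEnergy (α κ μ : ℝ) : Continuous fun x : Jets => jetEnergy α κ μ x 0 := by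
  have := continuous_prodL2_self
  simp only [jetEnergy, bilin]
  fun_prop

/-- Existence of a minimiser among the maps with `P₁₂ = 0`. -/
theorem exists_min_jetEnergy {α κ μ : ℝ} (hα : 0 < α) (hκ : 0 ≤ κ) (hκ' : κ < 1 / 16)
    (hμ : 0 ≤ μ) (x₀ : Jets) :
    ∃ x : Jets, (x : X).2.2.2 = (x₀ : X).2.2.2 ∧
      ∀ y : Jets, (y : X).2.2.2 = (x₀ : X).2.2.2 → jetEnergy α κ μ x 0 ≤ jetEnergy α κ μ y 0 := by
  obtain ⟨c, hc, hco⟩ := bilin_coercive hα hκ hκ'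
  -- The half-difference `(a - b)/2` has zero trace, and coercivity gives `2c‖(a - b)/2‖² = (c/2)‖a
  -- - b‖²`, hence the constant `c / 2`.
  refine exists_forall_le_of_midpoint (K := {x : Jets | (x : X).2.2.2 = (x₀ : X).2.2.2})
    (isClosed_eq (by fun_prop) continuous_const) ⟨x₀, rfl⟩
    (continuous_jetEnergy α κ μ) (m₀ := -(4 * κ) * ‖(x₀ : X).2.2.2‖ ^ 2) (c := c / 2)
    (fun x hx => ?_) (by positivity) fun a ha b hb => ?_
  · have h := bilin_self_ge hα.le hκ hκ'.le x
    rw [show (x : X).2.2.2 = (x₀ : X).2.2.2 from hx] at h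
    have h0 := bilin_self_nonneg hα.le hκ hκ'.le (x := 0) rfl
    have : 0 ≤ μ * ‖prodL2 x x + prodL2 0 0‖ ^ 2 := by positivity
    simp only [jetEnergy]
    linarith
  · have ha' : (a : X).2.2.2 = (x₀ : X).2.2.2 := ha
    have hb' : (b : X).2.2.2 = (x₀ : X).2.2.2 := hb
    refine ⟨(1 / 2 : ℝ) • (a + b), ?_, ?_⟩
    · change (1 / 2 : ℝ) • ((a : X).2.2.2 + (b : X).2.2.2) = _
      rw [ha', hb']
      module
    · have hd : (1 / 2 : ℝ) • (a - b) ∈ Jets₀ := by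
        change (1 / 2 : ℝ) • ((a : X).2.2.2 - (b : X).2.2.2) = 0
        rw [ha', hb', sub_self, smul_zero]
      have h := jetEnergy_midpoint (α := α) (κ := κ) hμ ((1 / 2 : ℝ) • (a + b))
        ((1 / 2 : ℝ) • (a - b))
      rw [show (1 / 2 : ℝ) • (a + b) + (1 / 2 : ℝ) • (a - b) = a by module,
        show (1 / 2 : ℝ) • (a + b) - (1 / 2 : ℝ) • (a - b) = b by module] at h
      have h2 := hco _ hd
      rw [norm_smul, mul_pow] at h2
      rw [show ‖(1 / 2 : ℝ)‖ = 1 / 2 by norm_num] at h2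
      linarith

/-- Minimality is known only against maps with second entry 0. A perturbation `t • b` of that entry
adds a nonnegative quadratic term and only enlarges `‖u² + w²‖`, so `t = 0` still minimises the full
energy along the line. -/
theorem firstVariation_eq_zero_of_min {α κ μ : ℝ} (hα : 0 < α) (hκ : 0 ≤ κ) (hκ' : κ < 1 / 16)
    (hμ : 0 ≤ μ) {x : Jets}
    (hx : ∀ y : Jets, (y : X).2.2.2 = (x : X).2.2.2 → jetEnergy α κ μ x 0 ≤ jetEnergy α κ μ y 0)
    {a b : Jets} (ha : a ∈ Jets₀) (hb : b ∈ Jets₀) : firstVariation α κ μ x 0 a b = 0 := by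
  refine IsLocalMin.hasDerivAt_eq_zero (.of_forall fun t => ?_)
    (hasDerivAt_jetEnergy α κ μ x 0 a b)
  have h1 : (x + t • a : X).2.2.2 = (x : X).2.2.2 := by
    change (x : X).2.2.2 + t • (a : X).2.2.2 = _
    rw [show (a : X).2.2.2 = 0 from ha, smul_zero, add_zero]
  have h2 := hx (x + t • a) h1
  have h3 : (t • b) ∈ Jets₀ := by
    change t • (b : X).2.2.2 = 0
    rw [show (b : X).2.2.2 = 0 from hb, smul_zero]
  have h4 := bilin_self_nonneg hα.le hκ hκ'.le h3
  have h5 : bilin α κ 0 0 = 0 := by simp [bilin]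
  have h6 : ‖prodL2 (x + t • a) (x + t • a)‖ ^ 2 ≤
      ‖prodL2 (x + t • a) (x + t • a) + prodL2 (t • b) (t • b)‖ ^ 2 := by
    rw [norm_add_sq_real]
    have := inner_prodL2_nonneg (x + t • a) (t • b)
    nlinarith [sq_nonneg ‖prodL2 (t • b) (t • b)‖]
  have h7 := mul_le_mul_of_nonneg_left h6 hμ
  simp only [zero_smul, add_zero, zero_add]
  refine h2.trans ?_
  simp only [jetEnergy, prodL2_zero, add_zero, h5]
  linarith

/-! ### `S₀`-valued maps in terms of jets -/

/-- The element of `S₀` with first row `(a, b)`. -/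
def mkS0 (a b : ℝ) : S0 :=
  ⟨!![a, b; b, -a], by
    refine ⟨?_, ?_⟩
    · ext i j; fin_cases i <;> fin_cases j <;> rfl
    · simp [Matrix.trace_fin_two]⟩

theorem entry_one_zero (P : ℝ × ℝ → S0) : entry P 1 0 = entry P 0 1 :=
  funext fun z => (P z).2.1.apply 0 1

theorem entry_one_one (P : ℝ × ℝ → S0) : entry P 1 1 = (-1 : ℝ) • entry P 0 0 := by
  funext z
  have h : (P z : Matrix (Fin 2) (Fin 2) ℝ) 0 0 + (P z : Matrix (Fin 2) (Fin 2) ℝ) 1 1 = 0 := by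
    rw [← Matrix.trace_fin_two]; exact (P z).2.2
  simp only [entry, Pi.smul_apply, smul_eq_mul]
  linarith

theorem S0_ext {A A' : S0}
    (h0 : (A : Matrix (Fin 2) (Fin 2) ℝ) 0 0 = (A' : Matrix (Fin 2) (Fin 2) ℝ) 0 0)
    (h1 : (A : Matrix (Fin 2) (Fin 2) ℝ) 0 1 = (A' : Matrix (Fin 2) (Fin 2) ℝ) 0 1) : A = A' := by
  have e : ∀ A : S0, ∀ i j, (A : Matrix (Fin 2) (Fin 2) ℝ) i j = entry (fun _ => A) i j 0 :=
    fun _ _ _ => rfl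
  refine Subtype.ext (Matrix.ext fun i j => ?_)
  fin_cases i <;> fin_cases j
  · exact h0
  · exact h1
  · change (A : Matrix (Fin 2) (Fin 2) ℝ) 1 0 = (A' : Matrix (Fin 2) (Fin 2) ℝ) 1 0
    rw [e, e A', entry_one_zero, entry_one_zero]; exact h1
  · change (A : Matrix (Fin 2) (Fin 2) ℝ) 1 1 = (A' : Matrix (Fin 2) (Fin 2) ℝ) 1 1
    rw [e, e A', entry_one_one, entry_one_one]
    exact congrArg (fun a : ℝ => (-1 : ℝ) • a) h0

theorem normSq_eq (A : Matrix (Fin 2) (Fin 2) ℝ) :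
    normSq A = A 0 0 ^ 2 + 2 * (A 0 1 * A 1 0) + A 1 1 ^ 2 := by
  simp only [normSq, Matrix.trace_fin_two, Matrix.mul_apply, Fin.sum_univ_two]
  ring

/-- Symmetry and zero trace make the other two entries copies, up to sign, of these two. -/
theorem mem_H1WithTrace_iff {G : ℝ × ℝ → S0} (hG0 : MemLp (entry G 0 0) 2 arcLength)
    (hG1 : MemLp (entry G 0 1) 2 arcLength) {P : ℝ × ℝ → S0} :
    P ∈ H1WithTrace G ↔ ∃ x y : X, Represents x (entry P 0 0) (entry G 0 0) ∧
      Represents y (entry P 0 1) (entry G 0 1) := by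
  constructor
  · intro h
    obtain ⟨x, hx⟩ := exists_represents (h 0 0).1 hG0 (h 0 0).2
    obtain ⟨y, hy⟩ := exists_represents (h 0 1).1 hG1 (h 0 1).2
    exact ⟨x, y, hx, hy⟩
  · rintro ⟨x, y, hx, hy⟩ i j
    have H : ∃ w, Represents w (entry P i j) (entry G i j) := by
      fin_cases i <;> fin_cases j
      · exact ⟨x, hx⟩
      · exact ⟨y, hy⟩
      · refine ⟨y, ?_⟩
        change Represents y (entry P 1 0) (entry G 1 0)
        rwa [entry_one_zero, entry_one_zero]
      · refine ⟨(-1 : ℝ) • x, ?_⟩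
        change Represents _ (entry P 1 1) (entry G 1 1)
        rw [entry_one_one, entry_one_one]
        exact hx.smul (-1)
    obtain ⟨w, hw⟩ := H
    exact ⟨hw.memH1, hw.hasTrace⟩

/-- The `(1, 1)` entry has its own hypothesis because `weakDeriv` is chosen separately for each
function, so linearity holds only almost everywhere. -/
theorem normSq_weakDerivS0 {e : ℝ × ℝ} {P : ℝ × ℝ → S0} {p q : ℝ × ℝ → ℝ}
    (hp : weakDeriv e (entry P 0 0) =ᵐ[area] p)
    (hp' : weakDeriv e (entry P 1 1) =ᵐ[area] (-1 : ℝ) • p)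
    (hq : weakDeriv e (entry P 0 1) =ᵐ[area] q) :
    (fun z => normSq (weakDerivS0 e P z)) =ᵐ[area] fun z => 2 * (p z ^ 2 + q z ^ 2) := by
  filter_upwards [hp, hp', hq] with z h1 h2 h3
  simp only [normSq_eq, weakDerivS0, Matrix.of_apply, entry_one_zero, h1, h2, h3, Pi.smul_apply,
    smul_eq_mul]
  ring

theorem energy_eq_jetEnergy (B C b lam : ℝ) (hC : C ≠ 0) {P : ℝ × ℝ → S0} {x y : Jets}
    {g g' : ℝ × ℝ → ℝ} (hx : Represents x (entry P 0 0) g) (hy : Represents y (entry P 0 1) g') :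
    energy B C b lam P =
      jetEnergy (1 / b ^ 2) (lam ^ 2 * B ^ 2 / (4 * C ^ 2)) (lam ^ 2 / 2) x y := by
  have hx' : Represents ((-1 : ℝ) • (x : X)) (entry P 1 1) ((-1 : ℝ) • g) := by
    rw [entry_one_one]; exact hx.smul (-1)
  have d1 := normSq_weakDerivS0 hx.hasWeakDeriv_x.weakDeriv_ae_eq
    (hx'.hasWeakDeriv_x.weakDeriv_ae_eq.trans (Lp.coeFn_smul _ _))
    hy.hasWeakDeriv_x.weakDeriv_ae_eq
  have d2 := normSq_weakDerivS0 hx.hasWeakDeriv_y.weakDeriv_ae_eq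
    (hx'.hasWeakDeriv_y.weakDeriv_ae_eq.trans (Lp.coeFn_smul _ _))
    hy.hasWeakDeriv_y.weakDeriv_ae_eq
  have hS : ∀ᵐ z ∂area, (prodL2 x x + prodL2 y y : Lp ℝ 2 area) z =
      (x : X).1 z ^ 2 + (y : X).1 z ^ 2 := by
    filter_upwards [Lp.coeFn_add (prodL2 x x) (prodL2 y y), coeFn_prodL2 x x, coeFn_prodL2 y y]
      with z h1 h2 h3
    rw [h1, Pi.add_apply, h2, h3]
    ring
  have sq : ∀ f : Lp ℝ 2 area, Integrable (fun z => f z ^ 2) area :=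
    fun f => (Lp.memLp f).integrable_sq
  set α := 1 / b ^ 2 with hα
  set κ := lam ^ 2 * B ^ 2 / (4 * C ^ 2) with hκ
  have key : energy B C b lam P = ∫ z, ((α * (x : X).2.1 z ^ 2 + (x : X).2.2.1 z ^ 2
      - κ * (x : X).1 z ^ 2) + (α * (y : X).2.1 z ^ 2 + (y : X).2.2.1 z ^ 2
      - κ * (y : X).1 z ^ 2) + lam ^ 2 / 2 * (prodL2 x x + prodL2 y y : Lp ℝ 2 area) z ^ 2)
      ∂area := by
    refine integral_congr_ae ?_
    filter_upwards [d1, d2, hS, hx.val, hy.val] with z h1 h2 h3 h4 h5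
    have h6 : normSq (P z) = 2 * ((x : X).1 z ^ 2 + (y : X).1 z ^ 2) := by
      have e0 : (P z : Matrix (Fin 2) (Fin 2) ℝ) 1 0 = entry P 1 0 z := rfl
      have e1 : (P z : Matrix (Fin 2) (Fin 2) ℝ) 1 1 = entry P 1 1 z := rfl
      rw [normSq_eq, e0, e1, entry_one_zero, entry_one_one, Pi.smul_apply, smul_eq_mul, ← h4, ← h5,
        h4, h5]
      simp only [entry]
      ring
    simp only [h1, h2, h3, h6, hα, hκ]
    -- For `b = 0` both gradient coefficients `1 / (2b²)` and `1 / b²` are 0 by convention, so the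
    -- identity persists.
    by_cases hb : b = 0
    · subst hb; field_simp; ring
    · field_simp; ring
  have i1 : ∀ w : Jets, Integrable (fun z => α * (w : X).2.1 z ^ 2 + (w : X).2.2.1 z ^ 2
      - κ * (w : X).1 z ^ 2) area := fun w =>
    (((sq _).const_mul α).add (sq _)).sub ((sq _).const_mul κ)
  have i2 : ∀ w : Jets, ∫ z, (α * (w : X).2.1 z ^ 2 + (w : X).2.2.1 z ^ 2
      - κ * (w : X).1 z ^ 2) ∂area = bilin α κ w w := fun w => by
    have i3 : Integrable (fun z => α * (w : X).2.1 z ^ 2 + (w : X).2.2.1 z ^ 2) area :=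
      ((sq _).const_mul α).add (sq _)
    rw [integral_sub i3 ((sq _).const_mul κ),
      integral_add ((sq _).const_mul α) (sq _), integral_const_mul, integral_const_mul, bilin_self,
      norm_sq_eq_integral _ .rfl, norm_sq_eq_integral _ .rfl, norm_sq_eq_integral _ .rfl]
  have i4 : Integrable (fun z => (α * (x : X).2.1 z ^ 2 + (x : X).2.2.1 z ^ 2
      - κ * (x : X).1 z ^ 2) + (α * (y : X).2.1 z ^ 2 + (y : X).2.2.1 z ^ 2
      - κ * (y : X).1 z ^ 2)) area := (i1 x).add (i1 y)
  rw [key, integral_add i4 ((sq _).const_mul _), integral_add (i1 x) (i1 y),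
    integral_const_mul, i2, i2, ← norm_sq_eq_integral _ .rfl, jetEnergy]

theorem hasDerivAt_energy (B C b lam : ℝ) (hC : C ≠ 0) {P V : ℝ × ℝ → S0} {x y v w : Jets}
    {g g' h h' : ℝ × ℝ → ℝ} (hx : Represents x (entry P 0 0) g) (hy : Represents y (entry P 0 1) g')
    (hv : Represents v (entry V 0 0) h) (hw : Represents w (entry V 0 1) h') :
    HasDerivAt (fun t : ℝ => energy B C b lam (P + t • V))
      (firstVariation (1 / b ^ 2) (lam ^ 2 * B ^ 2 / (4 * C ^ 2)) (lam ^ 2 / 2) x y v w) 0 := by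
  refine (hasDerivAt_jetEnergy _ _ _ x y v w).congr_of_eventuallyEq (.of_forall fun t => ?_)
  exact energy_eq_jetEnergy B C b lam hC (x := x + t • v) (y := y + t • w)
    (hx.add (hv.smul t)) (hy.add (hw.smul t))

theorem Represents.mem_Jets₀ {x : Jets} {u : ℝ × ℝ → ℝ} (h : Represents x u 0) : x ∈ Jets₀ :=
  Lp.ext (h.bd.trans (Lp.coeFn_zero _ _ _).symm)

theorem represents_of_mem_Jets₀ {x : Jets} (h : x ∈ Jets₀) : Represents x (x : X).1 0 :=
  ⟨x.2, .rfl, by rw [show (x : X).2.2.2 = 0 from h]; exact Lp.coeFn_zero _ _ _⟩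

/-- Critical points in terms of jets. -/
theorem isCriticalPoint_iff {B C ε b lam : ℝ} (hC : C ≠ 0) {P : ℝ × ℝ → S0} {x y : Jets}
    (hx : Represents x (entry P 0 0) (entry (Pbc B C ε) 0 0))
    (hy : Represents y (entry P 0 1) (entry (Pbc B C ε) 0 1)) :
    IsCriticalPoint B C ε b lam P ↔ ∀ v ∈ Jets₀, ∀ w ∈ Jets₀,
      firstVariation (1 / b ^ 2) (lam ^ 2 * B ^ 2 / (4 * C ^ 2)) (lam ^ 2 / 2) x y v w = 0 := by
  have z0 : ∀ i j, MemLp (entry (0 : ℝ × ℝ → S0) i j) 2 arcLength := fun i j => MemLp.zero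
  constructor
  · intro h v hv w hw
    have hv' := represents_of_mem_Jets₀ hv
    have hw' := represents_of_mem_Jets₀ hw
    set V : ℝ × ℝ → S0 := fun z => mkS0 ((v : X).1 z) ((w : X).1 z) with hV
    have hmem : V ∈ H1WithTrace 0 :=
      (mem_H1WithTrace_iff (z0 0 0) (z0 0 1)).2 ⟨v, w, hv', hw'⟩
    exact (hasDerivAt_energy B C b lam hC (V := V) hx hy hv' hw').unique (h.2 V hmem)
  · intro h
    refine ⟨(mem_H1WithTrace_iff ((memLp_congr_ae hx.bd).1 (Lp.memLp _))
      ((memLp_congr_ae hy.bd).1 (Lp.memLp _))).2 ⟨x, y, hx, hy⟩, fun V hV => ?_⟩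
    obtain ⟨v, w, hv, hw⟩ := (mem_H1WithTrace_iff (z0 0 0) (z0 0 1)).1 hV
    have := hasDerivAt_energy B C b lam hC hx hy (v := ⟨v, hv.mem⟩) (w := ⟨w, hw.mem⟩) hv hw
    rwa [h _ (Represents.mem_Jets₀ (x := ⟨v, hv.mem⟩) hv) _
      (Represents.mem_Jets₀ (x := ⟨w, hw.mem⟩) hw)] at this

/-! ### An admissible map -/

theorem tendsto_eLpNorm_of_bounded {μ : Measure (ℝ × ℝ)} [IsFiniteMeasure μ]
    (hμ : ∀ᵐ z ∂μ, z ∈ clOm) {f : ℕ → ℝ × ℝ → ℝ} {g : ℝ × ℝ → ℝ} {K : ℝ}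
    (hf : ∀ n, Continuous (f n)) (hb : ∀ n, ∀ z ∈ clOm, |f n z| ≤ K)
    (hl : ∀ z ∈ clOm, Tendsto (fun n => f n z) atTop (𝓝 (g z))) :
    MemLp g 2 μ ∧ Tendsto (fun n => eLpNorm (fun z => f n z - g z) 2 μ) atTop (𝓝 0) := by
  have mg : AEStronglyMeasurable g μ :=
    aestronglyMeasurable_of_tendsto_ae atTop (fun n => (hf n).aestronglyMeasurable)
      (hμ.mono fun z hz => hl z hz)
  have bg : ∀ z ∈ clOm, |g z| ≤ K := fun z hz =>
    le_of_tendsto (hl z hz).abs (.of_forall fun n => hb n z hz)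
  refine ⟨MemLp.of_bound mg K (hμ.mono bg), ?_⟩
  have h1 : Tendsto (fun n => ∫⁻ z, ‖f n z - g z‖ₑ ^ (2 : ℝ) ∂μ) atTop (𝓝 (∫⁻ _, 0 ∂μ)) := by
    refine tendsto_lintegral_of_dominated_convergence' (fun _ => ENNReal.ofReal (2 * K) ^ (2 : ℝ))
      (fun n => (((hf n).aestronglyMeasurable.sub mg).enorm.pow_const _)) (fun n => ?_) ?_ ?_
    · filter_upwards [hμ] with z hz
      gcongr
      rw [Real.enorm_eq_ofReal_abs]
      refine ENNReal.ofReal_le_ofReal ((abs_sub _ _).trans ?_)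
      linarith [hb n z hz, bg z hz]
    · rw [lintegral_const]
      exact ENNReal.mul_ne_top (by finiteness) (measure_ne_top _ _)
    · filter_upwards [hμ] with z hz
      have : Tendsto (fun n => f n z - g z) atTop (𝓝 0) := by
        simpa using (hl z hz).sub_const (g z)
      have h2 := (ENNReal.continuous_rpow_const (y := (2 : ℝ))).tendsto _ |>.comp this.enorm
      simpa using! h2
  rw [lintegral_zero] at h1
  have h2 := (ENNReal.continuous_rpow_const (y := (1 / 2 : ℝ))).tendsto _ |>.comp h1
  simp only [ENNReal.zero_rpow_of_pos (show (0 : ℝ) < 1 / 2 by norm_num)] at h2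
  refine h2.congr fun n => ?_
  rw [eLpNorm_eq_lintegral_rpow_enorm_toReal two_ne_zero (by simp)]
  simp

/-- Bounded pointwise limits of `C¹` functions whose derivatives converge boundedly pointwise. -/
theorem exists_represents_of_tendsto {v : ℕ → ℝ × ℝ → ℝ} {u p q : ℝ × ℝ → ℝ} {K : ℝ}
    (hv : ∀ n, ContDiff ℝ 1 (v n))
    (b0 : ∀ n, ∀ z ∈ clOm, |v n z| ≤ K)
    (b1 : ∀ n, ∀ z ∈ clOm, |fderiv ℝ (v n) z (1, 0)| ≤ K)
    (b2 : ∀ n, ∀ z ∈ clOm, |fderiv ℝ (v n) z (0, 1)| ≤ K)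
    (l0 : ∀ z ∈ clOm, Tendsto (fun n => v n z) atTop (𝓝 (u z)))
    (l1 : ∀ z ∈ clOm, Tendsto (fun n => fderiv ℝ (v n) z (1, 0)) atTop (𝓝 (p z)))
    (l2 : ∀ z ∈ clOm, Tendsto (fun n => fderiv ℝ (v n) z (0, 1)) atTop (𝓝 (q z))) :
    ∃ x, Represents x u u := by
  obtain ⟨m0, t0⟩ := tendsto_eLpNorm_of_bounded ae_area_mem_clOm (fun n => (hv n).continuous) b0 l0
  obtain ⟨m1, t1⟩ := tendsto_eLpNorm_of_bounded ae_area_mem_clOm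
    (fun n => continuous_fderiv_apply (hv n) _) b1 l1
  obtain ⟨m2, t2⟩ := tendsto_eLpNorm_of_bounded ae_area_mem_clOm
    (fun n => continuous_fderiv_apply (hv n) _) b2 l2
  obtain ⟨m3, t3⟩ := tendsto_eLpNorm_of_bounded ae_arcLength_mem_clOm
    (fun n => (hv n).continuous) b0 l0
  choose y hy using fun n => exists_isC1Jet (hv n)
  refine ⟨(m0.toLp, m1.toLp, m2.toLp, m3.toLp), ?_, m0.coeFn_toLp, m3.coeFn_toLp⟩
  refine isClosed_Jets.mem_of_tendsto (f := y) (b := atTop) ?_ (.of_forall fun n => (hy n).mem)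
  exact (tendsto_toLp_of_tendsto_eLpNorm m0 (fun n => (hy n).val) .rfl t0).prodMk_nhds
    ((tendsto_toLp_of_tendsto_eLpNorm m1 (fun n => (hy n).dx) .rfl t1).prodMk_nhds
      ((tendsto_toLp_of_tendsto_eLpNorm m2 (fun n => (hy n).dy) .rfl t2).prodMk_nhds
        (tendsto_toLp_of_tendsto_eLpNorm m3 (fun n => (hy n).bd) .rfl t3)))

/-- A smooth approximation of the positive part. -/
def smoothPos (δ t : ℝ) : ℝ := (t + √(t ^ 2 + δ)) / 2

theorem contDiff_smoothPos {δ : ℝ} (hδ : 0 < δ) : ContDiff ℝ 1 (smoothPos δ) := by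
  have : ∀ t : ℝ, t ^ 2 + δ ≠ 0 := fun t => by positivity
  have h : ContDiff ℝ 1 fun t : ℝ => √(t ^ 2 + δ) :=
    ContDiff.sqrt (by fun_prop) this
  exact (contDiff_id.add h).div_const 2

theorem hasDerivAt_smoothPos {δ : ℝ} (hδ : 0 < δ) (t : ℝ) :
    HasDerivAt (smoothPos δ) ((1 + t / √(t ^ 2 + δ)) / 2) t := by
  have h0 : t ^ 2 + δ ≠ 0 := by positivity
  have h : HasDerivAt (fun t : ℝ => t ^ 2 + δ) (2 * t) t := by
    simpa using! ((hasDerivAt_id t).pow 2).add_const δ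
  refine (((hasDerivAt_id t).add (h.sqrt h0)).div_const 2).congr_deriv ?_
  rw [mul_div_mul_left _ _ two_ne_zero]

theorem abs_smoothPos_le {δ t : ℝ} (hδ' : δ ≤ 1) : |smoothPos δ t| ≤ |t| + 1 := by
  have h : √(t ^ 2 + δ) ≤ |t| + 1 := by
    refine Real.sqrt_le_iff.2 ⟨by positivity, ?_⟩
    nlinarith [sq_abs t, abs_nonneg t]
  have h' := Real.sqrt_nonneg (t ^ 2 + δ)
  rw [smoothPos, abs_le]
  constructor <;> linarith [neg_abs_le t, le_abs_self t]

theorem abs_deriv_smoothPos_le {δ : ℝ} (hδ : 0 < δ) (t : ℝ) :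
    |(1 + t / √(t ^ 2 + δ)) / 2| ≤ 1 := by
  have h : |t / √(t ^ 2 + δ)| ≤ 1 := by
    rw [abs_div, abs_of_nonneg (Real.sqrt_nonneg _)]
    exact div_le_one_of_le₀ (Real.abs_le_sqrt (by linarith)) (Real.sqrt_nonneg _)
  rw [abs_le] at h ⊢
  constructor <;> linarith [h.1, h.2]

/-- The positive part is not `C¹`, so it is reached through `smoothPos (δ n)` with `δ n → 0`: values
and derivatives converge pointwise and boundedly on the closed square, hence in `L²`. -/
theorem exists_represents_posPart (L : ℝ × ℝ →L[ℝ] ℝ) (s : ℝ) :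
    ∃ x, Represents x (fun z => max (L z - s) 0) (fun z => max (L z - s) 0) := by
  set δ : ℕ → ℝ := fun n => 1 / ((n : ℝ) + 1) with hδ
  have δ0 : ∀ n, 0 < δ n := fun n => by positivity
  have δ1 : ∀ n, δ n ≤ 1 := fun n => by
    rw [hδ]; exact div_le_one_of_le₀ (by simp) (by positivity)
  have δl : Tendsto δ atTop (𝓝 0) := tendsto_one_div_add_atTop_nhds_zero_nat
  have hd : ∀ n z, HasFDerivAt (fun z => smoothPos (δ n) (L z - s))
      (((1 + (L z - s) / √((L z - s) ^ 2 + δ n)) / 2) • L) z := fun n z =>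
    HasDerivAt.comp_hasFDerivAt (h₂ := smoothPos (δ n)) (f := fun z => L z - s) z
      (hasDerivAt_smoothPos (δ0 n) (L z - s)) (L.hasFDerivAt.sub_const s)
  obtain ⟨K, hK⟩ := isCompact_clOm.exists_bound_of_continuousOn
    (f := fun z => L z - s) (by fun_prop)
  have hl : ∀ t : ℝ, Tendsto (fun n => √(t ^ 2 + δ n)) atTop (𝓝 |t|) := fun t => by
    rw [← Real.sqrt_sq_eq_abs]
    refine (Real.continuous_sqrt.tendsto _).comp ?_
    simpa using δl.const_add (t ^ 2)
  have hl' : ∀ t : ℝ, Tendsto (fun n => (1 + t / √(t ^ 2 + δ n)) / 2) atTop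
      (𝓝 ((1 + t / |t|) / 2)) := fun t => by
    -- At the kink, `0 / |0| = 0` gives the limit 1/2, which is the constant value of the
    -- approximating derivatives there, so convergence holds at every point.
    rcases eq_or_ne t 0 with rfl | ht
    · simp
    · exact ((tendsto_const_nhds.div (hl t) (abs_ne_zero.2 ht)).const_add 1).div_const 2
  have bd : ∀ n z (e : ℝ × ℝ), |fderiv ℝ (fun z => smoothPos (δ n) (L z - s)) z e| ≤ |L e| := by
    intro n z e
    rw [(hd n z).fderiv, smul_apply, smul_eq_mul, abs_mul]
    exact mul_le_of_le_one_left (abs_nonneg _) (abs_deriv_smoothPos_le (δ0 n) _)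
  have ld : ∀ z e, Tendsto (fun n => fderiv ℝ (fun z => smoothPos (δ n) (L z - s)) z e) atTop
      (𝓝 ((1 + (L z - s) / |L z - s|) / 2 * L e)) := fun z e => by
    simp only [(hd _ z).fderiv, smul_apply, smul_eq_mul]
    exact (hl' (L z - s)).mul_const _
  refine exists_represents_of_tendsto (v := fun n z => smoothPos (δ n) (L z - s))
    (K := (K + 1) + |L (1, 0)| + |L (0, 1)|)
    (fun n => (contDiff_smoothPos (δ0 n)).comp (by fun_prop)) (fun n z hz => ?_)
    (fun n z hz => (bd n z _).trans ?_) (fun n z hz => (bd n z _).trans ?_)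
    (fun z _ => ?_) (fun z _ => ld z _) (fun z _ => ld z _)
  · have h1 := abs_smoothPos_le (t := L z - s) (δ1 n)
    have h2 := hK z hz
    rw [Real.norm_eq_abs] at h2
    linarith [abs_nonneg (L (1, 0)), abs_nonneg (L (0, 1))]
  · have h2 := hK z hz
    linarith [abs_nonneg (L (0, 1)), norm_nonneg (L z - s)]
  · have h2 := hK z hz
    linarith [abs_nonneg (L (1, 0)), norm_nonneg (L z - s)]
  · have := ((hl (L z - s)).const_add (L z - s)).div_const 2
    have e : (L z - s + |L z - s|) / 2 = max (L z - s) 0 := by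
      rcases le_total 0 (L z - s) with h | h
      · rw [abs_of_nonneg h, max_eq_left h]; ring
      · rw [abs_of_nonpos h, max_eq_right h]; ring
    rwa [e] at this

/-- The trapezoidal function as a combination of positive parts. -/
def trapExt (ε t : ℝ) : ℝ :=
  ε⁻¹ * (max (t - -1) 0 + -1 * max (t - (-1 + ε)) 0 + -1 * max (t - (1 - ε)) 0)

theorem trapExt_eq_trap {ε t : ℝ} (hε : 0 < ε) (hε' : ε < 1 / 2) (ht : t ∈ Icc (-1 : ℝ) 1) :
    trapExt ε t = trap ε t := by
  obtain ⟨h1, h2⟩ := ht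
  unfold trapExt trap
  rw [max_eq_left (by linarith)]
  split_ifs with h3 h4
  · rw [max_eq_right (by linarith), max_eq_right (by linarith)]
    field_simp; ring
  · rw [max_eq_left (by linarith), max_eq_right (by linarith)]
    field_simp; ring
  · rw [max_eq_left (by linarith), max_eq_left (by linarith)]
    field_simp; ring

theorem trap_of_abs_eq_one {ε t : ℝ} (hε : 0 < ε) (hε' : ε < 1 / 2) (ht : |t| = 1) :
    trap ε t = 0 := by
  unfold trap
  rcases (abs_eq zero_le_one).1 ht with rfl | rfl
  · rw [if_neg (by linarith)]
    split_ifs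
    · linarith
    · norm_num
  · rw [if_pos (by linarith)]
    norm_num

theorem exists_represents_trapExt (ε : ℝ) (L : ℝ × ℝ →L[ℝ] ℝ) :
    ∃ x, Represents x (fun z => trapExt ε (L z)) (fun z => trapExt ε (L z)) := by
  obtain ⟨x1, h1⟩ := exists_represents_posPart L (-1)
  obtain ⟨x2, h2⟩ := exists_represents_posPart L (-1 + ε)
  obtain ⟨x3, h3⟩ := exists_represents_posPart L (1 - ε)
  exact ⟨_, ((h1.add (h2.smul (-1))).add (h3.smul (-1))).smul ε⁻¹⟩

/-- The extension is `(B/2C)(T(x) - T(y))`: `T` vanishes at `±1`, so on each edge exactly the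
prescribed term remains, and at the corners both vanish. -/
theorem exists_represents_Pbc (B C : ℝ) {ε : ℝ} (hε : 0 < ε) (hε' : ε < 1 / 2) :
    ∃ (x : X) (u : ℝ × ℝ → ℝ), Represents x u (entry (Pbc B C ε) 0 0) := by
  obtain ⟨x, hx⟩ := exists_represents_trapExt ε (ContinuousLinearMap.fst ℝ ℝ ℝ)
  obtain ⟨y, hy⟩ := exists_represents_trapExt ε (ContinuousLinearMap.snd ℝ ℝ ℝ)
  have h := (hx.add (hy.smul (-1))).smul (B / (2 * C))
  refine ⟨_, _, h.mem, h.val, h.bd.trans ?_⟩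
  filter_upwards [ae_arcLength_mem_edges] with z hz
  obtain ⟨⟨h1, h2⟩, h3⟩ := hz
  simp only [Pi.smul_apply, Pi.add_apply, smul_eq_mul, ContinuousLinearMap.coe_fst',
    ContinuousLinearMap.coe_snd', trapExt_eq_trap hε hε' h1, trapExt_eq_trap hε hε' h2]
  unfold entry Pbc
  split_ifs with h4
  · rw [trap_of_abs_eq_one hε hε' h4]
    simp [diagS0]
  · rw [trap_of_abs_eq_one hε hε' (h3.resolve_left h4)]
    simp [diagS0]

theorem entry_Pbc_zero_one (B C ε : ℝ) : entry (Pbc B C ε) 0 1 = 0 := by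
  funext z
  unfold entry Pbc
  split_ifs <;> rfl

end RLdG

end

/-! ### Existence, uniqueness and vanishing of the off-diagonal entry. -/

theorem mainTheorem1 (B C ε b lam : ℝ) (hB : 0 < B) (hC : 0 < C) (hε : 0 < ε) (hε' : ε < 1 / 2)
    (hb : 1 ≤ b) (hlam : 0 ≤ lam) (hlam' : lam < C / (2 * B)) :
    ∃ P : ℝ × ℝ → RLdG.S0,
      RLdG.IsCriticalPoint B C ε b lam P ∧
      (∀ Q : ℝ × ℝ → RLdG.S0, RLdG.IsCriticalPoint B C ε b lam Q → Q =ᵐ[RLdG.area] P) ∧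
      RLdG.entry P 0 1 =ᵐ[RLdG.area] 0 := by
  open RLdG in
  have hα : 0 < 1 / b ^ 2 := by positivity
  have hκ : 0 ≤ lam ^ 2 * B ^ 2 / (4 * C ^ 2) := by positivity
  -- Here `κ = (λB/(2C))²`, and `λ < C/(2B)` says that `λB/(2C) < 1/4`.
  have hκ' : lam ^ 2 * B ^ 2 / (4 * C ^ 2) < 1 / 16 := by
    rw [lt_div_iff₀ (by positivity)] at hlam'
    rw [div_lt_iff₀ (by positivity)]
    have h1 : (lam * (2 * B)) ^ 2 < C ^ 2 := by gcongr
    nlinarith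
  have hμ : 0 ≤ lam ^ 2 / 2 := by positivity
  obtain ⟨x₀, u₀, hx₀⟩ := exists_represents_Pbc B C hε hε'
  obtain ⟨x, hbd, hmin⟩ := exists_min_jetEnergy hα hκ hκ' hμ ⟨x₀, hx₀.mem⟩
  set P : ℝ × ℝ → S0 := fun z => mkS0 ((x : X).1 z) 0 with hP
  have hx : Represents x (entry P 0 0) (entry (Pbc B C ε) 0 0) :=
    ⟨x.2, .rfl, by rw [hbd]; exact hx₀.bd⟩
  have hy : Represents (0 : Jets) (entry P 0 1) (entry (Pbc B C ε) 0 1) := by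
    rw [entry_Pbc_zero_one]
    exact ⟨zero_mem _, Lp.coeFn_zero _ _ _, Lp.coeFn_zero _ _ _⟩
  have hcrit := (isCriticalPoint_iff (b := b) (lam := lam) hC.ne' hx hy).2 fun v hv w hw =>
    firstVariation_eq_zero_of_min hα hκ hκ' hμ (fun y h => hmin y (h.trans hbd)) hv hw
  refine ⟨P, hcrit, fun Q hQ => ?_, .of_forall fun z => rfl⟩
  obtain ⟨x', y', hx', hy'⟩ := (mem_H1WithTrace_iff ((memLp_congr_ae hx.bd).1 (Lp.memLp _))
    ((memLp_congr_ae hy.bd).1 (Lp.memLp _))).1 hQ.1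
  lift x' to Jets using hx'.mem
  lift y' to Jets using hy'.mem
  -- Two admissible maps share their trace, so their difference is an allowed test direction for
  -- both first variations.
  have ha : x' - x ∈ Jets₀ := sub_eq_zero.2 (Lp.ext (hx'.bd.trans hx.bd.symm))
  have hb' : y' - 0 ∈ Jets₀ := sub_eq_zero.2 (Lp.ext (hy'.bd.trans hy.bd.symm))
  have e0 := (isCriticalPoint_iff hC.ne' hx hy).1 hcrit _ ha _ hb'
  have e1 := (isCriticalPoint_iff hC.ne' hx' hy').1 hQ _ ha _ hb'
  obtain ⟨r0, r1⟩ := eq_of_firstVariation_eq_zero hα hκ hκ' hμ ha hb' e0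
    (by rwa [add_sub_cancel, add_sub_cancel])
  obtain rfl := sub_eq_zero.1 r0
  obtain rfl := sub_eq_zero.1 r1
  filter_upwards [hx'.val, hx.val, hy'.val, hy.val] with z h0 h1 h2 h3
  exact S0_ext (h0.symm.trans h1) (h2.symm.trans h3)
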